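/- Let $(M^{2n},J,\bar g)$ be an almost Hermitian manifold: $M$ is a smooth manifold, $J$ a smooth almost complex structure on $M$, and $\bar g$ a smooth Riemannian metric for which $J$ is an isometry; put $\bar\omega(u,v)=\bar g(Ju,v)$. Let $\widetilde\nabla$ be a smooth unitary connection on $TM$ (i.e. $\widetilde\nabla\bar g=0$ and $\widetilde\nabla J=0$; torsion is allowed), with curvature $$\widetilde R(X,Y)=[\widetilde\nabla_X,\widetilde\nabla_Y]-\widetilde\nabla_{[X,Y]}.$$ For $p\in M$ and $X,Y\in T_pM$ let $$\widetilde P(X,Y)=\sum_{j=1}^{2n}\bar\omega\big(\widetilde R(X,Y)\bar e_j,\bar e_j\big),$$ where $\bar e_1,\dots,\bar e_{2n}$ is any $\bar g$-orthonormal basis of $T_pM$. Let $\iota:L^n\to M$ be a totally real immersion, i.e. a smooth immersion of a smooth $n$-manifold such that $J(T_pL)\cap T_pL=\{0\}$ for all $p\in L$, where $T_pL$ is identified with $\iota_*(T_pL)\subset T_{\iota(p)}M$. Let $\pi_J$ be the projection of $T_{\iota(p)}M=T_pL\oplus J(T_pL)$ onto $J(T_pL)$. For $X\in T_pL$ the operator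 $J\pi_J\widetilde\nabla_X$, applied to vector fields tangent to $L$ (with the pull-back connection on $\iota^*TM$), defines an endomorphism of $T_pL$; let $$\xi_J(X)=\operatorname{tr}_L\big(J\pi_J\widetilde\nabla_X\big)$$ be the Maslov $1$-form, where $\operatorname{tr}_L$ is the trace of endomorphisms of $T_pL$. Then $\xi_J$ is a smooth $1$-form on $L$ and, for all $p\in L$ and $X,Y\in T_pL$, $$d\xi_J(X,Y)=\operatorname{tr}_L\big(J\pi_J\widetilde R(X,Y)\big)=\tfrac12\widetilde P(X,Y),$$ where $d\xi(X,Y)=X(\xi(Y))-Y(\xi(X))-\xi([X,Y])$ and $\widetilde R$ and $\widetilde P$ are evaluated on $\iota_*X,\iota_*Y$. Moreover $\widetilde R(\iota_*X,\iota_*Y)$ is a complex linear endomorphism of $(T_{\iota(p)}M,J)$ and $\tfrac12\widetilde P(X,Y)=i\operatorname{tr}_{\mathbb C}\widetilde R(X,Y)$; that is, $d\xi_J$ is the restriction to $L$ of the Chern--Weil form $i\operatorname{tr}_{\mathbb C}\widetilde R$ of $2\pi c_1(M)$. -/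

import Mathlib

open Bundle Module FiberBundle VectorField
open scoped Manifold ContDiff Topology

namespace TotallyReal

noncomputable section

set_option linter.unusedSectionVars false

/-! ### Linear algebra -/

section LinearAlgebra

variable {V : Type*} [AddCommGroup V] [Module ℝ V]

/-- With respect to a complex structure `J`, a subspace `P` is totally real if
`J(P) ∩ P = {0}`. -/
def IsTotallyRealPlane (J : V →ₗ[ℝ] V) (P : Submodule ℝ V) : Prop :=
  P.map J ⊓ P = ⊥

/-- A half-dimensional totally real plane gives the decomposition `V = P ⊕ J(P)`. -/
theorem IsTotallyRealPlane.isCompl [FiniteDimensional ℝ V] {J : V →ₗ[ℝ] V}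
    (hJ : ∀ v, J (J v) = -v) {P : Submodule ℝ V} (hP : IsTotallyRealPlane J P)
    (hdim : finrank ℝ V = 2 * finrank ℝ P) : IsCompl P (P.map J) := by
  have hinj : Function.Injective J := fun v w h => by
    have h2 := congrArg J h
    rw [hJ, hJ] at h2
    exact neg_injective h2
  have hr : finrank ℝ (P.map J) = finrank ℝ P :=
    (Submodule.equivMapOfInjective J hinj P).finrank_eq.symm
  have hd : Disjoint P (P.map J) := by
    rw [disjoint_iff, inf_comm]; exact hP
  refine ⟨hd, codisjoint_iff.2 (Submodule.eq_top_of_finrank_eq ?_)⟩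
  have h3 := Submodule.finrank_sup_add_finrank_inf_eq P (P.map J)
  rw [disjoint_iff.1 hd, finrank_bot, hr] at h3
  omega

/-- The structure of complex vector space on `V` defined by `J`: `(a + i b) v = a v + b J v`. -/
@[reducible]
def complexModule (J : V →ₗ[ℝ] V) (hJ : ∀ v, J (J v) = -v) : Module ℂ V :=
  Module.compHom V
    (Complex.lift ⟨(J : Module.End ℝ V), by ext v; simp [hJ]⟩ : ℂ →ₐ[ℝ] Module.End ℝ V).toRingHom

/-- The real endomorphism `A` of `V` is complex linear for the complex structure `J`,
and its trace as an endomorphism of the complex vector space `(V, J)` is `t`. -/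
def HasComplexTrace (J : V →ₗ[ℝ] V) (hJ : ∀ v, J (J v) = -v) (A : V →ₗ[ℝ] V) (t : ℂ) : Prop :=
  letI : Module ℂ V := complexModule J hJ
  ∃ A' : V →ₗ[ℂ] V, (∀ v, A' v = A v) ∧ LinearMap.trace ℂ V A' = t

end LinearAlgebra

variable {E : Type*} [NormedAddCommGroup E] [NormedSpace ℝ E]
  {M : Type*} [TopologicalSpace M] [ChartedSpace E M]

instance finiteDimensional_tangentSpace [FiniteDimensional ℝ E] (x : M) :
    FiniteDimensional ℝ (TangentSpace 𝓘(ℝ, E) x) :=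
  inferInstanceAs (FiniteDimensional ℝ E)

instance t2Space_tangentSpace (x : M) : T2Space (TangentSpace 𝓘(ℝ, E) x) :=
  inferInstanceAs (T2Space E)

variable [IsManifold 𝓘(ℝ, E) ∞ M]

/-! ### Almost Hermitian manifolds and unitary connections -/

variable (E M) in
/-- A smooth almost complex structure on `M`. -/
structure AlmostComplexStructure where
  /-- The endomorphism of each tangent space. -/
  toFun : ∀ x : M, TangentSpace 𝓘(ℝ, E) x →L[ℝ] TangentSpace 𝓘(ℝ, E) x
  contMDiff : ContMDiff 𝓘(ℝ, E) (𝓘(ℝ, E).prod 𝓘(ℝ, E →L[ℝ] E)) ∞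
    (fun x => TotalSpace.mk' (E →L[ℝ] E) x (toFun x))
  sq : ∀ (x : M) (v : TangentSpace 𝓘(ℝ, E) x), toFun x (toFun x v) = -v

variable (E M) in
/-- A smooth Riemannian metric on `M`. -/
abbrev Metric :=
  ContMDiffRiemannianMetric 𝓘(ℝ, E) ∞ E (fun x : M => TangentSpace 𝓘(ℝ, E) x)

variable (E M) in
/-- A connection on the tangent bundle of `M`; `∇_u Y` at `x` is written `D Y x u`. -/
abbrev Connection :=
  CovariantDerivative 𝓘(ℝ, E) E (fun x : M => TangentSpace 𝓘(ℝ, E) x)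

/-- The metric `g` is compatible with `J`, that is, `J` is an isometry of `g`. -/
def IsAlmostHermitian (g : Metric E M) (J : AlmostComplexStructure E M) : Prop :=
  ∀ (x : M) (v w : TangentSpace 𝓘(ℝ, E) x),
    g.inner x (J.toFun x v) (J.toFun x w) = g.inner x v w

/-- The positive (1,1)-form `ω(v, w) = g(J v, w)`. -/
def fundamentalForm (g : Metric E M) (J : AlmostComplexStructure E M) (x : M)
    (v w : TangentSpace 𝓘(ℝ, E) x) : ℝ :=
  g.inner x (J.toFun x v) w

/-- A connection is unitary if it preserves both the metric and the almost complex structure: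
`∇ g = 0` and `∇ J = 0`. -/
structure IsUnitary (D : Connection E M) (g : Metric E M) (J : AlmostComplexStructure E M) :
    Prop where
  metric : ∀ (x : M) (u : TangentSpace 𝓘(ℝ, E) x) (Y Z : ∀ y : M, TangentSpace 𝓘(ℝ, E) y),
    MDiffAt (T% Y) x → MDiffAt (T% Z) x →
    mvfderiv 𝓘(ℝ, E) (fun y => g.inner y (Y y) (Z y)) x u =
      g.inner x (D Y x u) (Z x) + g.inner x (Y x) (D Z x u)
  complex : ∀ (x : M) (u : TangentSpace 𝓘(ℝ, E) x) (Y : ∀ y : M, TangentSpace 𝓘(ℝ, E) y),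
    MDiffAt (T% Y) x → D (fun y => J.toFun y (Y y)) x u = J.toFun x (D Y x u)

/-! ### Curvature -/

/-- `∇_X ∇_Y Z - ∇_Y ∇_X Z - ∇_[X,Y] Z` at `x`, for vector fields `X`, `Y`, `Z`. -/
def curvatureFields (D : Connection E M) (X Y Z : ∀ y : M, TangentSpace 𝓘(ℝ, E) y) (x : M) :
    TangentSpace 𝓘(ℝ, E) x :=
  D (fun y => D Z y (Y y)) x (X x) - D (fun y => D Z y (X y)) x (Y x)
    - D Z x (mlieBracket 𝓘(ℝ, E) X Y x)

theorem eventually_extend_add (x : M) (v w : TangentSpace 𝓘(ℝ, E) x) :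
    ∀ᶠ y in 𝓝 x, (extend E (v + w) : ∀ y : M, TangentSpace 𝓘(ℝ, E) y) y =
      (extend E v + extend E w : ∀ y : M, TangentSpace 𝓘(ℝ, E) y) y := by
  have hx := mem_baseSet_trivializationAt' (F := E) (E := TangentSpace 𝓘(ℝ, E)) x
  set e := trivializationAt E (TangentSpace 𝓘(ℝ, E)) x with he
  filter_upwards [e.open_baseSet.mem_nhds hx] with y hy
  have h1 : (e ⟨x, v + w⟩).2 = (e ⟨x, v⟩).2 + (e ⟨x, w⟩).2 := (e.linear ℝ hx).1 v w
  simp only [extend, Pi.add_apply, ← he, h1]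
  have h2 := (e.symmₗ ℝ y).map_add (e ⟨x, v⟩).2 (e ⟨x, w⟩).2
  simpa only [Trivialization.symmₗ_apply (R := ℝ) e hy] using h2

theorem eventually_extend_smul (x : M) (c : ℝ) (v : TangentSpace 𝓘(ℝ, E) x) :
    ∀ᶠ y in 𝓝 x, (extend E (c • v) : ∀ y : M, TangentSpace 𝓘(ℝ, E) y) y =
      (c • extend E v : ∀ y : M, TangentSpace 𝓘(ℝ, E) y) y := by
  have hx := mem_baseSet_trivializationAt' (F := E) (E := TangentSpace 𝓘(ℝ, E)) x
  set e := trivializationAt E (TangentSpace 𝓘(ℝ, E)) x with he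
  filter_upwards [e.open_baseSet.mem_nhds hx] with y hy
  have h1 : (e ⟨x, c • v⟩).2 = c • (e ⟨x, v⟩).2 := (e.linear ℝ hx).2 c v
  simp only [extend, Pi.smul_apply, ← he, h1]
  have h2 := (e.symmₗ ℝ y).map_smul c (e ⟨x, v⟩).2
  simpa only [Trivialization.symmₗ_apply (R := ℝ) e hy] using h2

/-- `extend E v` is differentiable near the base point. -/
theorem eventually_mdifferentiableAt_extend (x : M) (v : TangentSpace 𝓘(ℝ, E) x) :
    ∀ᶠ y in 𝓝 x, MDiffAt (T% (extend E v : ∀ y : M, TangentSpace 𝓘(ℝ, E) y)) y := by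
  obtain ⟨s, hs, h⟩ := exists_mdifferentiableOn_extend 𝓘(ℝ, E) E v
  filter_upwards [eventually_mem_nhds_iff.2 hs] with y hy
  exact (h y (mem_of_mem_nhds hy)).mdifferentiableAt hy

theorem eventually_cov_extend_add (D : Connection E M) (x : M) (v w : TangentSpace 𝓘(ℝ, E) x) :
    ∀ᶠ y in 𝓝 x, D (extend E (v + w)) y = D (extend E v) y + D (extend E w) y := by
  filter_upwards [eventually_eventually_nhds.2 (eventually_extend_add x v w),
    eventually_mdifferentiableAt_extend x v, eventually_mdifferentiableAt_extend x w,
    eventually_mdifferentiableAt_extend x (v + w)] with y hy hv hw hvw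
  rw [← D.isCovariantDerivativeOnUniv.add hv hw]
  exact D.isCovariantDerivativeOnUniv.congr_of_eventuallyEq hvw
    (mdifferentiableAt_add_section hv hw) Filter.univ_mem hy

theorem eventually_cov_extend_smul (D : Connection E M) (x : M) (c : ℝ)
    (v : TangentSpace 𝓘(ℝ, E) x) :
    ∀ᶠ y in 𝓝 x, D (extend E (c • v)) y = c • D (extend E v) y := by
  filter_upwards [eventually_eventually_nhds.2 (eventually_extend_smul x c v),
    eventually_mdifferentiableAt_extend x v,
    eventually_mdifferentiableAt_extend x (c • v)] with y hy hv hcv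
  rw [← D.isCovariantDerivativeOnUniv.smul_const c hv]
  exact D.isCovariantDerivativeOnUniv.congr_of_eventuallyEq hcv
    (mdifferentiableAt_const.smul_section hv) Filter.univ_mem hy

/-- For a smooth connection, `∇_Y Z` is differentiable at `x` when `Z` is `extend E w`. -/
theorem mdifferentiableAt_cov_extend [FiniteDimensional ℝ E] [T2Space M] (D : Connection E M)
    [hD : D.ContMDiffCovariantDerivative ∞] (x : M) (w : TangentSpace 𝓘(ℝ, E) x)
    (Y : ∀ y : M, TangentSpace 𝓘(ℝ, E) y) (hY : MDiffAt (T% Y) x) :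
    MDiffAt (T% (fun y => D (extend E w) y (Y y))) x := by
  obtain ⟨s, hs, h⟩ := exists_contMDiffOn_extend (k := ∞) 𝓘(ℝ, E) E w
  obtain ⟨u, hus, huo, hxu⟩ := mem_nhds_iff.1 hs
  obtain ⟨ψ, -, hψ⟩ := (SmoothBumpFunction.nhds_basis_tsupport (I := 𝓘(ℝ, E)) x).mem_iff.1
    (huo.mem_nhds hxu)
  set W : ∀ y : M, TangentSpace 𝓘(ℝ, E) y := (ψ : M → ℝ) • extend E w with hW
  have hWs : ContMDiff 𝓘(ℝ, E) (𝓘(ℝ, E).prod 𝓘(ℝ, E)) ∞ (T% W) :=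
    ContMDiffOn.smul_section_of_tsupport ψ.contMDiff.contMDiffOn huo hψ (h.mono hus)
  have hcov := (hD.contMDiff.contMDiff (σ := W) (hWs.contMDiffOn)).contMDiffAt
    (x := x) Filter.univ_mem
  have h2 := MDifferentiableAt.clm_bundle_apply (hcov.mdifferentiableAt (by simp)) hY
  refine h2.congr_of_eventuallyEq ?_
  filter_upwards [eventually_eventually_nhds.2 ψ.eventuallyEq_one,
    eventually_mdifferentiableAt_extend x w] with y hy hwy
  have heq : D (extend E w) y = D W y := by
    refine IsCovariantDerivativeOn.congr_of_eventuallyEq D.isCovariantDerivativeOnUniv hwy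
      ((hWs y).mdifferentiableAt (by simp)) Filter.univ_mem ?_
    filter_upwards [hy] with z hz
    simp [hW, hz]
  rw [heq]

variable [FiniteDimensional ℝ E] [T2Space M]

/-- The curvature `R(u, v)` of a smooth connection, as an endomorphism of the tangent space
at `x`; the tangent vectors are extended to vector fields which are smooth near `x`. -/
def curvature (D : Connection E M) [D.ContMDiffCovariantDerivative ∞] (x : M)
    (u v : TangentSpace 𝓘(ℝ, E) x) : TangentSpace 𝓘(ℝ, E) x →ₗ[ℝ] TangentSpace 𝓘(ℝ, E) x where
  toFun w := curvatureFields D (extend E u) (extend E v) (extend E w) x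
  map_add' w w' := by
    have key : ∀ Y : ∀ y : M, TangentSpace 𝓘(ℝ, E) y, MDiffAt (T% Y) x →
        D (fun y => D (extend E (w + w')) y (Y y)) x =
          D (fun y => D (extend E w) y (Y y)) x + D (fun y => D (extend E w') y (Y y)) x := by
      intro Y hY
      have h1 := mdifferentiableAt_cov_extend D x w Y hY
      have h2 := mdifferentiableAt_cov_extend D x w' Y hY
      have h3 := mdifferentiableAt_cov_extend D x (w + w') Y hY
      rw [← D.isCovariantDerivativeOnUniv.add h1 h2]
      refine D.isCovariantDerivativeOnUniv.congr_of_eventuallyEq h3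
        (mdifferentiableAt_add_section h1 h2) Filter.univ_mem ?_
      filter_upwards [eventually_cov_extend_add D x w w'] with y hy
      rw [hy]
      rfl
    have h0 := (eventually_cov_extend_add D x w w').self_of_nhds
    simp only [curvatureFields, key _ (mdifferentiableAt_extend ..), h0,
      _root_.add_apply]
    abel
  map_smul' c w := by
    have key : ∀ Y : ∀ y : M, TangentSpace 𝓘(ℝ, E) y, MDiffAt (T% Y) x →
        D (fun y => D (extend E (c • w)) y (Y y)) x =
          c • D (fun y => D (extend E w) y (Y y)) x := by
      intro Y hY
      have h1 := mdifferentiableAt_cov_extend D x w Y hY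
      have h3 := mdifferentiableAt_cov_extend D x (c • w) Y hY
      rw [← D.isCovariantDerivativeOnUniv.smul_const c h1]
      refine D.isCovariantDerivativeOnUniv.congr_of_eventuallyEq h3
        (mdifferentiableAt_const.smul_section h1) Filter.univ_mem ?_
      filter_upwards [eventually_cov_extend_smul D x c w] with y hy
      rw [hy]
      rfl
    have h0 := (eventually_cov_extend_smul D x c w).self_of_nhds
    simp only [curvatureFields, key _ (mdifferentiableAt_extend ..), h0,
      _root_.smul_apply, RingHom.id_apply, smul_sub]

/-- `P(u, v) = ∑ⱼ ω(R(u, v) eⱼ, eⱼ)`, to be used with an orthonormal basis `e`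
of the tangent space. -/
def chernForm {ι : Type*} [Fintype ι] (D : Connection E M) [D.ContMDiffCovariantDerivative ∞]
    (g : Metric E M) (J : AlmostComplexStructure E M) (x : M)
    (e : Basis ι ℝ (TangentSpace 𝓘(ℝ, E) x)) (u v : TangentSpace 𝓘(ℝ, E) x) : ℝ :=
  ∑ j, fundamentalForm g J x (curvature D x u v (e j)) (e j)

/-! ### Totally real immersions -/

variable {F : Type*} [NormedAddCommGroup F] [NormedSpace ℝ F] [FiniteDimensional ℝ F]
  {L : Type*} [TopologicalSpace L] [ChartedSpace F L] [IsManifold 𝓘(ℝ, F) ∞ L]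

variable (F L) in
/-- A totally real immersion of a half-dimensional manifold `L` into `(M, J)`: a smooth
immersion such that each plane `ι_*(T_pL)` is totally real. -/
structure TotallyRealImmersion (J : AlmostComplexStructure E M) where
  /-- The immersion `ι`. -/
  toFun : L → M
  contMDiff : ContMDiff 𝓘(ℝ, F) 𝓘(ℝ, E) ∞ toFun
  injective_mfderiv : ∀ p : L, Function.Injective (mfderiv 𝓘(ℝ, F) 𝓘(ℝ, E) toFun p)
  finrank_eq : finrank ℝ E = 2 * finrank ℝ F
  totallyReal : ∀ p : L, IsTotallyRealPlane (J.toFun (toFun p)).toLinearMap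
    (mfderiv 𝓘(ℝ, F) 𝓘(ℝ, E) toFun p).toLinearMap.range

/-- The covariant derivative `∇_u Y` at `p ∈ L` of a section `Y` of `f^* TM` with respect to the
pull-back by `f : L → M` of a connection `D` on `TM`. In a local frame `(s_k)` of `TM` near
`f(p)`, with `Y = ∑ Y^k (s_k ∘ f)`, it is
`∑ dY^k(u) s_k + ∑ Y^k(p) ∇_{f_* u} s_k`. The second sum is the derivative of the
section of `TM` with constant coefficients `Y^k(p)`, which is `extend E (Y p)`. -/
def pullbackCov (D : Connection E M) (f : L → M) (Y : ∀ q : L, TangentSpace 𝓘(ℝ, E) (f q))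
    (p : L) : TangentSpace 𝓘(ℝ, F) p →L[ℝ] TangentSpace 𝓘(ℝ, E) (f p) :=
  letI e := trivializationAt E (TangentSpace 𝓘(ℝ, E)) (f p)
  (e.symmL ℝ (f p)).comp
      (mvfderiv 𝓘(ℝ, F) (fun q => e.continuousLinearMapAt ℝ (f q) (Y q)) p)
    + (D (extend E (Y p)) (f p)).comp (mfderiv 𝓘(ℝ, F) 𝓘(ℝ, E) f p)

/-- The coordinates of a differentiable section of `f^* TM` are differentiable. -/
theorem mdifferentiableAt_coord {f : L → M} {Y : ∀ q : L, TangentSpace 𝓘(ℝ, E) (f q)} {p : L}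
    (hY : MDifferentiableAt 𝓘(ℝ, F) (𝓘(ℝ, E).prod 𝓘(ℝ, E))
      (fun q => TotalSpace.mk' E (f q) (Y q)) p) :
    MDifferentiableAt 𝓘(ℝ, F) 𝓘(ℝ, E) (fun q =>
      (trivializationAt E (TangentSpace 𝓘(ℝ, E)) (f p)).continuousLinearMapAt ℝ (f q) (Y q)) p := by
  have h := (mdifferentiableAt_totalSpace 𝓘(ℝ, E) _).1 hY
  have hf : ContinuousAt f p := h.1.continuousAt
  refine h.2.congr_of_eventuallyEq ?_
  filter_upwards [hf.preimage_mem_nhds ((trivializationAt E (TangentSpace 𝓘(ℝ, E))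
    (f p)).open_baseSet.mem_nhds (mem_baseSet_trivializationAt' (f p)))] with q hq
  rw [Trivialization.continuousLinearMapAt_apply, Trivialization.coe_linearMapAt_of_mem _ hq]

theorem pullbackCov_add (D : Connection E M) {f : L → M}
    {Y Y' : ∀ q : L, TangentSpace 𝓘(ℝ, E) (f q)} {p : L}
    (hY : MDifferentiableAt 𝓘(ℝ, F) (𝓘(ℝ, E).prod 𝓘(ℝ, E))
      (fun q => TotalSpace.mk' E (f q) (Y q)) p)
    (hY' : MDifferentiableAt 𝓘(ℝ, F) (𝓘(ℝ, E).prod 𝓘(ℝ, E))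
      (fun q => TotalSpace.mk' E (f q) (Y' q)) p) :
    pullbackCov (F := F) D f (fun q => Y q + Y' q) p =
      pullbackCov D f Y p + pullbackCov D f Y' p := by
  have h0 := (eventually_cov_extend_add D (f p) (Y p) (Y' p)).self_of_nhds
  simp only [pullbackCov, map_add, h0]
  rw [mvfderiv_fun_add (mdifferentiableAt_coord hY) (mdifferentiableAt_coord hY')]
  ext u
  simp
  abel

theorem pullbackCov_smul (D : Connection E M) {f : L → M} {a : L → ℝ}
    {Y : ∀ q : L, TangentSpace 𝓘(ℝ, E) (f q)} {p : L} (ha : MDifferentiableAt 𝓘(ℝ, F) 𝓘(ℝ) a p)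
    (hY : MDifferentiableAt 𝓘(ℝ, F) (𝓘(ℝ, E).prod 𝓘(ℝ, E))
      (fun q => TotalSpace.mk' E (f q) (Y q)) p) (u : TangentSpace 𝓘(ℝ, F) p) :
    pullbackCov (F := F) D f (fun q => a q • Y q) p u =
      a p • pullbackCov D f Y p u + mvfderiv 𝓘(ℝ, F) a p u • Y p := by
  have h0 := (eventually_cov_extend_smul D (f p) (a p) (Y p)).self_of_nhds
  simp only [pullbackCov, map_smul, h0]
  rw [mvfderiv_fun_smul ha (mdifferentiableAt_coord hY)]
  have h1 := Trivialization.symmL_continuousLinearMapAt (R := ℝ)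
    (trivializationAt E (TangentSpace 𝓘(ℝ, E)) (f p))
    (mem_baseSet_trivializationAt' (F := E) (E := TangentSpace 𝓘(ℝ, E)) (f p)) (Y p)
  simp only [_root_.add_apply, ContinuousLinearMap.comp_apply, _root_.smul_apply,
    ContinuousLinearMap.smulRight_apply, map_add, map_smul, h1, smul_add]
  abel

/-- The defining property of the pull-back connection: `∇_u (Z ∘ f) = ∇_{f_* u} Z` for every
vector field `Z` on `M`. -/
theorem pullbackCov_comp (D : Connection E M) {f : L → M} {p : L}
    (hf : MDifferentiableAt 𝓘(ℝ, F) 𝓘(ℝ, E) f p) {Z : ∀ y : M, TangentSpace 𝓘(ℝ, E) y}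
    (hZ : MDiffAt (T% Z) (f p)) (u : TangentSpace 𝓘(ℝ, F) p) :
    pullbackCov D f (fun q => Z (f q)) p u = D Z (f p) (mfderiv 𝓘(ℝ, F) 𝓘(ℝ, E) f p u) := by
  have hcomp : ∀ {W : ∀ y : M, TangentSpace 𝓘(ℝ, E) y}, MDiffAt (T% W) (f p) →
      MDifferentiableAt 𝓘(ℝ, F) (𝓘(ℝ, E).prod 𝓘(ℝ, E))
        (fun q => TotalSpace.mk' E (f q) (W (f q))) p :=
    fun hW => MDifferentiableAt.comp p hW hf
  have ht : TensorialAt 𝓘(ℝ, E) E (fun W : ∀ y : M, TangentSpace 𝓘(ℝ, E) y =>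
      pullbackCov D f (fun q => W (f q)) p u - D W (f p) (mfderiv 𝓘(ℝ, F) 𝓘(ℝ, E) f p u))
      (f p) := by
    constructor
    · intro a W ha hW
      have h1 := pullbackCov_smul D (a := a ∘ f) (ha.comp p hf) (hcomp hW) u
      rw [mvfderiv_comp p ha hf] at h1
      simp only [Pi.smul_apply', D.isCovariantDerivativeOnUniv.leibniz hW ha]
      simp only [Function.comp_apply] at h1
      rw [h1]
      simp [smul_sub]
    · intro W W' hW hW'
      simp only [Pi.add_apply, D.isCovariantDerivativeOnUniv.add hW hW']
      rw [pullbackCov_add D (hcomp hW) (hcomp hW')]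
      simp only [_root_.add_apply]
      abel
  have h0 := ht.pointwise hZ (mdifferentiableAt_extend 𝓘(ℝ, E) E (Z (f p))) (by simp)
  rw [← sub_eq_zero]
  refine h0.trans ?_
  have hb := mem_baseSet_trivializationAt' (F := E) (E := TangentSpace 𝓘(ℝ, E)) (f p)
  set e := trivializationAt E (TangentSpace 𝓘(ℝ, E)) (f p) with he
  have hconst : mvfderiv 𝓘(ℝ, F) (fun q => e.continuousLinearMapAt ℝ (f q)
      (extend E (Z (f p)) (f q))) p = 0 := by
    have hev : (fun q => e.continuousLinearMapAt ℝ (f q) (extend E (Z (f p)) (f q))) =ᶠ[𝓝 p]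
        fun _ => (e ⟨f p, Z (f p)⟩).2 := by
      filter_upwards [hf.continuousAt.preimage_mem_nhds (e.open_baseSet.mem_nhds hb)] with q hq
      rw [Trivialization.continuousLinearMapAt_apply, Trivialization.coe_linearMapAt_of_mem _ hq,
        extend, ← he]
      have h4 := congrArg Prod.snd (Trivialization.apply_mk_symm e hq (e ⟨f p, Z (f p)⟩).2)
      exact h4
    rw [mvfderiv, hev.mfderiv_eq, mfderiv_const]
    exact ContinuousLinearMap.comp_zero _
  simp only [pullbackCov, _root_.add_apply, ContinuousLinearMap.comp_apply, extend_apply_self]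
  have h3 : mvfderiv 𝓘(ℝ, F) (fun q =>
      (trivializationAt E (TangentSpace 𝓘(ℝ, E)) (f p)).continuousLinearMapAt ℝ (f q)
        (extend E (Z (f p)) (f q))) p = 0 := hconst
  rw [h3]
  simp

namespace TotallyRealImmersion

variable {J : AlmostComplexStructure E M} (φ : TotallyRealImmersion F L J)

/-- The differential `ι_* : T_pL → T_{ι(p)}M`. -/
def push (p : L) : TangentSpace 𝓘(ℝ, F) p →L[ℝ] TangentSpace 𝓘(ℝ, E) (φ.toFun p) :=
  mfderiv 𝓘(ℝ, F) 𝓘(ℝ, E) φ.toFun p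

theorem push_injective (p : L) : Function.Injective (φ.push p).toLinearMap :=
  φ.injective_mfderiv p

/-- The plane `T_pL`, seen as a subspace of `T_{ι(p)}M`. -/
abbrev plane (p : L) : Submodule ℝ (TangentSpace 𝓘(ℝ, E) (φ.toFun p)) :=
  (φ.push p).toLinearMap.range

/-- `J` at the point `ι(p)`, as a linear map. -/
abbrev cplx (p : L) :
    TangentSpace 𝓘(ℝ, E) (φ.toFun p) →ₗ[ℝ] TangentSpace 𝓘(ℝ, E) (φ.toFun p) :=
  (J.toFun (φ.toFun p)).toLinearMap

/-- The decomposition `T_{ι(p)}M = T_pL ⊕ J(T_pL)`. -/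
theorem isCompl (p : L) : IsCompl (φ.plane p) ((φ.plane p).map (φ.cplx p)) := by
  refine IsTotallyRealPlane.isCompl (J.sq _) (φ.totallyReal p) ?_
  have h : finrank ℝ (φ.plane p) = finrank ℝ F :=
    LinearMap.finrank_range_of_inj (φ.push_injective p)
  rw [h]
  exact φ.finrank_eq

/-- The projection `π_J` of `T_{ι(p)}M` onto `J(T_pL)`, with kernel `T_pL`. -/
def piJ (p : L) : TangentSpace 𝓘(ℝ, E) (φ.toFun p) →ₗ[ℝ] TangentSpace 𝓘(ℝ, E) (φ.toFun p) :=
  ((φ.plane p).map (φ.cplx p)).projection (φ.plane p) (φ.isCompl p).symm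

theorem cplx_piJ_mem (p : L) (v : TangentSpace 𝓘(ℝ, E) (φ.toFun p)) :
    φ.cplx p (φ.piJ p v) ∈ φ.plane p := by
  obtain ⟨w, hw, h⟩ := Submodule.projection_apply_mem (φ.isCompl p).symm v
  rw [piJ, ← h]
  have h2 : φ.cplx p (φ.cplx p w) = -w := J.sq _ w
  rw [h2]
  exact neg_mem hw

/-- The map `J π_J : T_{ι(p)}M → T_pL`, where `T_pL` is identified with its image by `ι_*`. -/
def JpiJ (p : L) : TangentSpace 𝓘(ℝ, E) (φ.toFun p) →ₗ[ℝ] TangentSpace 𝓘(ℝ, F) p :=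
  (LinearEquiv.ofInjective (φ.push p).toLinearMap (φ.push_injective p)).symm.toLinearMap ∘ₗ
    (φ.cplx p ∘ₗ φ.piJ p).codRestrict (φ.plane p) (φ.cplx_piJ_mem p)

theorem JpiJ_push (p : L) (v : TangentSpace 𝓘(ℝ, F) p) : φ.JpiJ p (φ.push p v) = 0 := by
  have h : φ.piJ p (φ.push p v) = 0 := by
    rw [piJ, Submodule.projection_apply_eq_zero_iff]
    exact ⟨v, rfl⟩
  have h2 : (φ.cplx p ∘ₗ φ.piJ p).codRestrict (φ.plane p) (φ.cplx_piJ_mem p) (φ.push p v) = 0 := by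
    ext
    simp [h]
  rw [JpiJ, LinearMap.comp_apply, h2, map_zero]

/-- If `Y` is a vector field on `L` which is differentiable at `p`, so is `ι_* Y`. -/
theorem mdifferentiableAt_push {p : L} {Y : ∀ q : L, TangentSpace 𝓘(ℝ, F) q}
    (hY : MDiffAt (T% Y) p) :
    MDifferentiableAt 𝓘(ℝ, F) (𝓘(ℝ, E).prod 𝓘(ℝ, E))
      (fun q => TotalSpace.mk' E (φ.toFun q) (φ.push q (Y q))) p := by
  have h1 : ContMDiff 𝓘(ℝ, F).tangent 𝓘(ℝ, E).tangent 1
      (tangentMap 𝓘(ℝ, F) 𝓘(ℝ, E) φ.toFun) :=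
    φ.contMDiff.contMDiff_tangentMap (by norm_num; exact ENat.LEInfty.out)
  have h2 := (h1 ⟨p, Y p⟩).mdifferentiableAt one_ne_zero
  exact MDifferentiableAt.comp p h2 hY

/-- `Y ↦ J π_J ∇_u Y` is tensorial on the vector fields `Y` tangent to `L`. -/
theorem tensorialAt (D : Connection E M) (p : L) (u : TangentSpace 𝓘(ℝ, F) p) :
    TensorialAt 𝓘(ℝ, F) F (fun Y : ∀ q : L, TangentSpace 𝓘(ℝ, F) q =>
      φ.JpiJ p (pullbackCov D φ.toFun (fun q => φ.push q (Y q)) p u)) p where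
  smul {a Y} ha hY := by
    simp only [Pi.smul_apply', map_smul]
    rw [pullbackCov_smul D ha (φ.mdifferentiableAt_push hY)]
    simp [φ.JpiJ_push]
  add {Y Y'} hY hY' := by
    simp only [Pi.add_apply, map_add]
    rw [pullbackCov_add D (φ.mdifferentiableAt_push hY) (φ.mdifferentiableAt_push hY')]
    simp

/-- The endomorphism `J π_J ∇_u` of `T_pL`: it maps the value at `p` of any vector field `Y`
on `L` which is differentiable at `p` to `J π_J ∇_u (ι_* Y)`. -/
def maslovEndomorphism (D : Connection E M) (p : L) (u : TangentSpace 𝓘(ℝ, F) p) :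
    TangentSpace 𝓘(ℝ, F) p →L[ℝ] TangentSpace 𝓘(ℝ, F) p :=
  TensorialAt.mkHom _ p (φ.tensorialAt D p u)

/-- The Maslov 1-form `ξ_J(u) = tr_L (J π_J ∇_u)`. -/
def maslovForm (D : Connection E M) (p : L) : TangentSpace 𝓘(ℝ, F) p →L[ℝ] ℝ :=
  LinearMap.toContinuousLinearMap
    { toFun := fun u => LinearMap.trace ℝ (TangentSpace 𝓘(ℝ, F) p)
        (φ.maslovEndomorphism D p u).toLinearMap
      map_add' := fun u u' => by
        rw [← map_add]
        congr 1
        ext v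
        simp [maslovEndomorphism, TensorialAt.mkHom_apply_eq_extend]
      map_smul' := fun c u => by
        rw [RingHom.id_apply, ← map_smul]
        congr 1
        ext v
        simp [maslovEndomorphism, TensorialAt.mkHom_apply_eq_extend] }

/-- `tr_L (J π_J R(u, v))`, the trace of the endomorphism `w ↦ J π_J R(ι_* u, ι_* v) ι_* w`
of `T_pL`. -/
def traceCurvature (D : Connection E M) [D.ContMDiffCovariantDerivative ∞] (p : L)
    (u v : TangentSpace 𝓘(ℝ, F) p) : ℝ :=
  LinearMap.trace ℝ (TangentSpace 𝓘(ℝ, F) p)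
    (φ.JpiJ p ∘ₗ curvature D (φ.toFun p) (φ.push p u) (φ.push p v) ∘ₗ (φ.push p).toLinearMap)

end TotallyRealImmersion

/-- The exterior derivative `dξ(X, Y) = X(ξ(Y)) - Y(ξ(X)) - ξ([X, Y])` at `p` of a 1-form `ξ`,
evaluated on vector fields. -/
def extDerivOneForm (ξ : ∀ p : L, TangentSpace 𝓘(ℝ, F) p →L[ℝ] ℝ)
    (X Y : ∀ p : L, TangentSpace 𝓘(ℝ, F) p) (p : L) : ℝ :=
  mvfderiv 𝓘(ℝ, F) (fun q => ξ q (Y q)) p (X p) - mvfderiv 𝓘(ℝ, F) (fun q => ξ q (X q)) p (Y p)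
    - ξ p (mlieBracket 𝓘(ℝ, F) X Y p)

end

end TotallyReal

/-! The proof works in the charts centred at `p` and `ι(p)`. Let `Φ` be the differential of the
immersion, `Q` the map `J π_J` and `Γ` the pulled-back connection form, all in coordinates. Then
`ξ_J(u) = tr (Q N_u)` with `N_u = ∂_u Φ + Γ(u) Φ`, and three pointwise relations describe the
totally real splitting: `Q Φ = 0`, `Q J Φ = -1` and `1 = -Φ Q J - J Φ Q`.

Differentiating the first two relations and substituting `∂_u J = [J, Γ(u)]`, which is `∇J = 0`,
determines `∂_u Q` on the images of `Φ` and of `J Φ`. By the third relation these span the whole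
space, and `∂_u Q = Q Γ(u) + (Q N_u) Q J + (Q J N_u) Q`. In `∂_u tr (Q N_v) - ∂_v tr (Q N_u)` the
terms quadratic in `N` cancel because `tr (AB) = tr (BA)`, the second derivatives of `Φ` cancel by
symmetry, and what is left is `tr (Q (dΓ + Γ ∧ Γ)(u, v) Φ)`, the trace of the curvature. This is
`trace_moving_frame` and `extDeriv_trace_moving_frame`; `extDerivOneForm_maslovForm` brings it back
to the manifold.

The second equality is linear algebra. Since `∇J = 0`, the curvature `R` commutes with `J`, and a
basis of `T_pL` is a complex basis of `(T_{ι(p)}M, J)`. In it `R` has matrix `A + i B` with `B = -Q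
R Φ`, so the trace over `T_pL` is minus the imaginary part of `t = tr_ℂ R`
(`exists_hasComplexTrace`). The real trace of `J R`, which is `P`, equals `-2 Im t`. Since `∇g = 0`,
`R` is skew-symmetric, its real trace `2 Re t` vanishes, and `i t = -Im t = P / 2`. -/

namespace TotallyReal

noncomputable section

set_option maxSynthPendingDepth 5
set_option linter.unusedSectionVars false

/-! ### Calculus of moving frames and of curvature in a vector space -/

section Flat

variable {F : Type*} [NormedAddCommGroup F] [NormedSpace ℝ F] [FiniteDimensional ℝ F]
  {E : Type*} [NormedAddCommGroup E] [NormedSpace ℝ E]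

variable (F) in
/-- The trace of continuous endomorphisms of a finite-dimensional space. -/
def traceCLM : (F →L[ℝ] F) →L[ℝ] ℝ :=
  LinearMap.toContinuousLinearMap (LinearMap.trace ℝ F ∘ₗ ContinuousLinearMap.coeLM ℝ)

theorem traceCLM_apply (A : F →L[ℝ] F) : traceCLM F A = LinearMap.trace ℝ F A.toLinearMap := rfl

theorem traceCLM_comp_comm (A B : F →L[ℝ] F) : traceCLM F (A ∘L B) = traceCLM F (B ∘L A) := by
  simp only [traceCLM_apply]
  exact LinearMap.trace_mul_comm ℝ A.toLinearMap B.toLinearMap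

/-- The algebraic part of the computation of the exterior derivative of the Maslov form. -/
theorem trace_moving_frame {Q dQu dQv : E →L[ℝ] F} {Φ dΦu dΦv : F →L[ℝ] E}
    {J dJu dJv Γu Γv : E →L[ℝ] E}
    (hid : ∀ x, x = -Φ (Q (J x)) - J (Φ (Q x)))
    (hQu : ∀ x, dQu (Φ x) + Q (dΦu x) = 0) (hQv : ∀ x, dQv (Φ x) + Q (dΦv x) = 0)
    (hQJu : ∀ x, dQu (J (Φ x)) + Q (dJu (Φ x)) + Q (J (dΦu x)) = 0)
    (hQJv : ∀ x, dQv (J (Φ x)) + Q (dJv (Φ x)) + Q (J (dΦv x)) = 0)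
    (hJu : ∀ x, dJu x = J (Γu x) - Γu (J x)) (hJv : ∀ x, dJv x = J (Γv x) - Γv (J x)) :
    traceCLM F (dQu ∘L (dΦv + Γv ∘L Φ) + Q ∘L Γv ∘L dΦu) -
      traceCLM F (dQv ∘L (dΦu + Γu ∘L Φ) + Q ∘L Γu ∘L dΦv) =
    traceCLM F (Q ∘L (Γu ∘L Γv - Γv ∘L Γu) ∘L Φ) := by
  -- `hid` splits a vector into a part in the image of `Φ` and a part in the image of `J Φ`; on
  -- these two images the differentiated relations give `dQ`. The terms in `Γ` recombine to `Q Γ`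
  -- once `Q Γ` is applied to the same splitting.
  have key : ∀ {dQ : E →L[ℝ] F} {dΦ : F →L[ℝ] E} {dJ Γ : E →L[ℝ] E}
      (_ : ∀ x, dQ (Φ x) + Q (dΦ x) = 0)
      (_ : ∀ x, dQ (J (Φ x)) + Q (dJ (Φ x)) + Q (J (dΦ x)) = 0)
      (_ : ∀ x, dJ x = J (Γ x) - Γ (J x)) (N : F →L[ℝ] E),
      dQ ∘L N = Q ∘L Γ ∘L N + (Q ∘L (dΦ + Γ ∘L Φ)) ∘L (Q ∘L J ∘L N)
        + (Q ∘L J ∘L (dΦ + Γ ∘L Φ)) ∘L (Q ∘L N) := by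
    intro dQ dΦ dJ Γ h1 h2 h3 N
    have h4 : ∀ x, dQ x = Q (Γ x) + Q (dΦ (Q (J x)) + Γ (Φ (Q (J x))))
        + Q (J (dΦ (Q x) + Γ (Φ (Q x)))) := by
      intro x
      have e1 := h1 (Q (J x))
      have e2 := h2 (Q x)
      have e3 := congrArg dQ (hid x)
      have e4 := congrArg (fun y => Q (Γ y)) (hid x)
      rw [h3] at e2
      simp only [map_sub, map_neg, map_add] at e1 e2 e3 e4 ⊢
      rw [e3, e4, eq_neg_of_add_eq_zero_left e1]
      have e5 : dQ (J (Φ (Q x))) =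
          -Q (J (dΦ (Q x))) - (Q (J (Γ (Φ (Q x)))) - Q (Γ (J (Φ (Q x))))) := by
        rw [← sub_eq_zero, ← e2]; abel
      rw [e5]
      abel
    ext w
    simpa using h4 (N w)
  rw [key hQu hQJu hJu, key hQv hQJv hJv]
  set Nu := dΦu + Γu ∘L Φ with hNu
  set Nv := dΦv + Γv ∘L Φ with hNv
  -- Exchanging the factors turns the two quadratic terms for `(u, v)` into those for `(v, u)`, so
  -- they drop out of the difference.
  have c1 := traceCLM_comp_comm (Q ∘L Nu) (Q ∘L J ∘L Nv)
  have c2 := traceCLM_comp_comm (Q ∘L J ∘L Nu) (Q ∘L Nv)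
  have e : Q ∘L (Γu ∘L Γv - Γv ∘L Γu) ∘L Φ =
      (Q ∘L Γu ∘L Nv + Q ∘L Γv ∘L dΦu) - (Q ∘L Γv ∘L Nu + Q ∘L Γu ∘L dΦv) := by
    ext w
    simp [hNu, hNv]
    abel
  rw [e]
  simp only [map_add, map_sub, c1, c2]
  ring

/-- The exterior derivative of `u ↦ tr (Q (∂_u Φ + Γ(u) Φ))` on an open subset of a vector space. -/
theorem extDeriv_trace_moving_frame {x₀ : F} {Φ : F → F →L[ℝ] E} {dΦ : F → F →L[ℝ] F →L[ℝ] E}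
    {d2Φ : F →L[ℝ] F →L[ℝ] F →L[ℝ] E}
    {Γ : F → F →L[ℝ] E →L[ℝ] E} {dΓ : F →L[ℝ] F →L[ℝ] E →L[ℝ] E}
    {J : F → E →L[ℝ] E} {dJ : F →L[ℝ] E →L[ℝ] E} {Q : F → E →L[ℝ] F} {dQ : F →L[ℝ] E →L[ℝ] F}
    (hΦ : HasFDerivAt Φ (dΦ x₀) x₀) (hdΦ : HasFDerivAt dΦ d2Φ x₀)
    (hΓ : HasFDerivAt Γ dΓ x₀) (hJ : HasFDerivAt J dJ x₀) (hQ : HasFDerivAt Q dQ x₀)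
    (hsymm : ∀ u v, d2Φ u v = d2Φ v u)
    (hid : ∀ x, x = -Φ x₀ (Q x₀ (J x₀ x)) - J x₀ (Φ x₀ (Q x₀ x)))
    (hQΦ : ∀ᶠ x in 𝓝 x₀, Q x ∘L Φ x = 0) (hQJΦ : ∀ᶠ x in 𝓝 x₀, Q x ∘L J x ∘L Φ x = -1)
    (hdJ : ∀ u x, dJ u x = J x₀ (Γ x₀ u x) - Γ x₀ u (J x₀ x)) (u v : F) :
    fderiv ℝ (fun x => traceCLM F (Q x ∘L (dΦ x v + Γ x v ∘L Φ x))) x₀ u -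
      fderiv ℝ (fun x => traceCLM F (Q x ∘L (dΦ x u + Γ x u ∘L Φ x))) x₀ v =
    traceCLM F (Q x₀ ∘L (dΓ u v - dΓ v u + (Γ x₀ u ∘L Γ x₀ v - Γ x₀ v ∘L Γ x₀ u)) ∘L Φ x₀) := by
  -- The derivative is grouped into the part treated by `trace_moving_frame`, the second derivative
  -- of `Φ`, which is symmetric, and the derivative of `Γ`, which gives the `dΓ` part of the
  -- curvature.
  have hd : ∀ u v : F, fderiv ℝ (fun x => traceCLM F (Q x ∘L (dΦ x v + Γ x v ∘L Φ x))) x₀ u =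
      traceCLM F (dQ u ∘L (dΦ x₀ v + Γ x₀ v ∘L Φ x₀) + Q x₀ ∘L Γ x₀ v ∘L dΦ x₀ u) +
        traceCLM F (Q x₀ ∘L d2Φ u v) + traceCLM F (Q x₀ ∘L dΓ u v ∘L Φ x₀) := by
    intro u v
    have h1 := (hdΦ.clm_apply (hasFDerivAt_const v x₀)).add
      ((hΓ.clm_apply (hasFDerivAt_const v x₀)).clm_comp hΦ)
    have h2 := (traceCLM F).hasFDerivAt.comp x₀ (hQ.clm_comp h1)
    have h3 := congrArg (fun A => A u) h2.fderiv
    refine h3.trans ?_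
    rw [← map_add, ← map_add]
    simp only [ContinuousLinearMap.comp_apply]
    congr 1
    ext w
    simp
    abel
  have hQu : ∀ u x, dQ u (Φ x₀ x) + Q x₀ (dΦ x₀ u x) = 0 := by
    intro u x
    have h1 := (hQ.clm_comp hΦ).unique ((hasFDerivAt_const 0 x₀).congr_of_eventuallyEq hQΦ)
    have h2 := congrArg (fun A => A u x) h1
    simp at h2
    rw [← h2]; abel
  have hQJu : ∀ u x, dQ u (J x₀ (Φ x₀ x)) + Q x₀ (dJ u (Φ x₀ x)) + Q x₀ (J x₀ (dΦ x₀ u x)) = 0 := by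
    intro u x
    have h1 := (hQ.clm_comp (hJ.clm_comp hΦ)).unique
      ((hasFDerivAt_const (-1) x₀).congr_of_eventuallyEq hQJΦ)
    have h2 := congrArg (fun A => A u x) h1
    simp at h2
    rw [← h2]; abel
  have h := trace_moving_frame hid (hQu u) (hQu v) (hQJu u) (hQJu v) (hdJ u) (hdJ v)
  rw [hd, hd, hsymm u v]
  have e : Q x₀ ∘L (dΓ u v - dΓ v u + (Γ x₀ u ∘L Γ x₀ v - Γ x₀ v ∘L Γ x₀ u)) ∘L Φ x₀ =
      Q x₀ ∘L dΓ u v ∘L Φ x₀ - Q x₀ ∘L dΓ v u ∘L Φ x₀ +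
        Q x₀ ∘L (Γ x₀ u ∘L Γ x₀ v - Γ x₀ v ∘L Γ x₀ u) ∘L Φ x₀ := by
    ext w; simp
  have e' := congrArg (traceCLM F) e
  rw [map_add, map_sub] at e'
  rw [e', ← h]
  ring

/-- If `∂_u J = [J, Γ(u)]`, the curvature `dΓ + Γ ∧ Γ` commutes with `J`. -/
theorem flat_curvature_commute {x₀ : E} {Γ : E → E →L[ℝ] E →L[ℝ] E}
    {dΓ : E →L[ℝ] E →L[ℝ] E →L[ℝ] E} {J : E → E →L[ℝ] E} (hΓ : HasFDerivAt Γ dΓ x₀)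
    (hJ : ContDiffAt ℝ ∞ J x₀)
    (hdJ : ∀ᶠ x in 𝓝 x₀, ∀ u, fderiv ℝ J x u = J x ∘L Γ x u - Γ x u ∘L J x) (u v w : E) :
    (dΓ u v - dΓ v u + (Γ x₀ u ∘L Γ x₀ v - Γ x₀ v ∘L Γ x₀ u)) (J x₀ w) =
      J x₀ ((dΓ u v - dΓ v u + (Γ x₀ u ∘L Γ x₀ v - Γ x₀ v ∘L Γ x₀ u)) w) := by
  have hJ1 := (hJ.differentiableAt (by simp)).hasFDerivAt
  have hJ2 : HasFDerivAt (fderiv ℝ J) (fderiv ℝ (fderiv ℝ J) x₀) x₀ :=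
    ((hJ.fderiv_right (m := 1) (by norm_num; exact ENat.LEInfty.out)).differentiableAt
      (by simp)).hasFDerivAt
  have hs := (hJ.isSymmSndFDerivAt (by simpa using ENat.LEInfty.out)) u v
  -- The equation `∂_v J = [J, Γ(v)]` is differentiated along `u`. Antisymmetrised in `u` and `v`,
  -- the left side vanishes and the right side becomes the commutator of `J` with `dΓ + Γ ∧ Γ`.
  have hd : ∀ u v w, fderiv ℝ (fderiv ℝ J) x₀ u v w =
      (fderiv ℝ J x₀ u (Γ x₀ v w) + J x₀ (dΓ u v w)) -
        (dΓ u v (J x₀ w) + Γ x₀ v (fderiv ℝ J x₀ u w)) := by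
    intro u v w
    have h0 := hΓ.clm_apply (hasFDerivAt_const v x₀)
    have h1 := (hJ1.clm_comp h0).sub (h0.clm_comp hJ1)
    have h2 := hJ2.clm_apply (hasFDerivAt_const v x₀)
    have h3 := h2.unique (h1.congr_of_eventuallyEq (by
      filter_upwards [hdJ] with x hx using hx v))
    have h4 := congrArg (fun A => A u w) h3
    simp at h4
    rw [h4]
    abel
  have h1 := congrArg (fun A => A w) hs
  simp only [hd, hdJ.self_of_nhds] at h1
  rw [← sub_eq_zero] at h1 ⊢
  simp only [_root_.sub_apply, _root_.add_apply, ContinuousLinearMap.comp_apply, map_sub,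
    map_add] at h1 ⊢
  rw [← neg_eq_zero, ← h1]
  abel

/-- If `∂_u g = g(Γ(u) ·, ·) + g(·, Γ(u) ·)`, the curvature `dΓ + Γ ∧ Γ` is skew-symmetric. -/
theorem flat_curvature_skew {x₀ : E} {Γ : E → E →L[ℝ] E →L[ℝ] E}
    {dΓ : E →L[ℝ] E →L[ℝ] E →L[ℝ] E} {G : E → E →L[ℝ] E →L[ℝ] ℝ} (hΓ : HasFDerivAt Γ dΓ x₀)
    (hG : ContDiffAt ℝ ∞ G x₀)
    (hdG : ∀ᶠ x in 𝓝 x₀, ∀ u a b, fderiv ℝ G x u a b = G x (Γ x u a) b + G x a (Γ x u b))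
    (u v a b : E) :
    G x₀ ((dΓ u v - dΓ v u + (Γ x₀ u ∘L Γ x₀ v - Γ x₀ v ∘L Γ x₀ u)) a) b =
      -G x₀ a ((dΓ u v - dΓ v u + (Γ x₀ u ∘L Γ x₀ v - Γ x₀ v ∘L Γ x₀ u)) b) := by
  have hG1 := (hG.differentiableAt (by simp)).hasFDerivAt
  have hG2 : HasFDerivAt (fderiv ℝ G) (fderiv ℝ (fderiv ℝ G) x₀) x₀ :=
    ((hG.fderiv_right (m := 1) (by norm_num; exact ENat.LEInfty.out)).differentiableAt
      (by simp)).hasFDerivAt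
  have hs := (hG.isSymmSndFDerivAt (by simpa using ENat.LEInfty.out)) u v
  -- The same argument with the second derivative of the metric: its symmetry is the skew-symmetry
  -- of `dΓ + Γ ∧ Γ`.
  have hd : ∀ u v, fderiv ℝ (fderiv ℝ G) x₀ u v a b =
      fderiv ℝ G x₀ u (Γ x₀ v a) b + G x₀ (dΓ u v a) b +
        (fderiv ℝ G x₀ u a (Γ x₀ v b) + G x₀ a (dΓ u v b)) := by
    intro u v
    have ha := (hΓ.clm_apply (hasFDerivAt_const v x₀)).clm_apply (hasFDerivAt_const a x₀)
    have hb := (hΓ.clm_apply (hasFDerivAt_const v x₀)).clm_apply (hasFDerivAt_const b x₀)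
    have h1 := ((hG1.clm_apply ha).clm_apply (hasFDerivAt_const b x₀)).add
      ((hG1.clm_apply (hasFDerivAt_const a x₀)).clm_apply hb)
    have h2 := ((hG2.clm_apply (hasFDerivAt_const v x₀)).clm_apply
      (hasFDerivAt_const a x₀)).clm_apply (hasFDerivAt_const b x₀)
    have h3 := h2.unique (h1.congr_of_eventuallyEq (by
      filter_upwards [hdG] with x hx using hx v a b))
    have h4 := congrArg (fun A => A u) h3
    simp at h4
    rw [h4]
    ring
  have h1 := congrArg (fun A => A a b) hs
  simp only [hd, hdG.self_of_nhds] at h1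
  simp only [_root_.sub_apply, _root_.add_apply, ContinuousLinearMap.comp_apply, map_sub,
    map_add] at h1 ⊢
  linarith

end Flat

/-! ### Smoothness of the projection attached to a totally real frame -/

section MovingFrame

variable {F : Type*} [NormedAddCommGroup F] [NormedSpace ℝ F] [FiniteDimensional ℝ F]
  {E : Type*} [NormedAddCommGroup E] [NormedSpace ℝ E]

/-- The component `Q` on `J(P)` depends smoothly on the totally real plane `P`, the image of `Φ`. -/
theorem contDiffAt_of_frame {n : WithTop ℕ∞} {x₀ : F} {Φ : F → F →L[ℝ] E} {J : F → E →L[ℝ] E}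
    {Q : F → E →L[ℝ] F} (hΦ : ContDiffAt ℝ n Φ x₀) (hJ : ContDiffAt ℝ n J x₀)
    (hJJ : ∀ᶠ x in 𝓝 x₀, ∀ v, J x (J x v) = -v)
    (hQΦ : ∀ᶠ x in 𝓝 x₀, ∀ w, Q x (Φ x w) = 0)
    (hQJΦ : ∀ᶠ x in 𝓝 x₀, ∀ w, Q x (J x (Φ x w)) = -w)
    (hid : ∀ᶠ x in 𝓝 x₀, ∀ v, v = -Φ x (Q x (J x v)) - J x (Φ x (Q x v))) :
    ContDiffAt ℝ n Q x₀ := by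
  have : CompleteSpace F := FiniteDimensional.complete ℝ F
  -- `T x (a, b) = Φ a + J Φ b` is invertible because the plane is totally real, and the second
  -- component of its inverse is `-Q`. Smoothness of `Q` thus follows from smoothness of inversion
  -- of continuous linear maps.
  set T : F → F × F →L[ℝ] E := fun x =>
    Φ x ∘L ContinuousLinearMap.fst ℝ F F + (J x ∘L Φ x) ∘L ContinuousLinearMap.snd ℝ F F with hT
  have hTs : ContDiffAt ℝ n T x₀ :=
    (hΦ.clm_comp contDiffAt_const).add ((hJ.clm_comp hΦ).clm_comp contDiffAt_const)
  have hinv : ∀ᶠ x in 𝓝 x₀, ∃ e : (F × F) ≃L[ℝ] E, (e : F × F →L[ℝ] E) = T x ∧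
      ∀ v, (e.symm v).2 = -Q x v := by
    filter_upwards [hJJ, hQΦ, hQJΦ, hid] with x h1 h2 h3 h4
    refine ⟨ContinuousLinearEquiv.equivOfInverse (T x)
      ((-(Q x ∘L J x)).prod (-Q x)) ?_ ?_, ?_, ?_⟩
    · rintro ⟨a, b⟩
      simp [hT, h1, h2, h3]
    · intro v
      simp only [hT]
      conv_rhs => rw [h4 v]
      simp
      abel
    · ext <;> rfl
    · intro v
      rfl
  obtain ⟨e₀, he₀, -⟩ := hinv.self_of_nhds
  have h1 : ContDiffAt ℝ n (fun x => (T x).inverse) x₀ := by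
    have h2 : ContDiffAt ℝ n ContinuousLinearMap.inverse (T x₀) := he₀ ▸ contDiffAt_map_inverse e₀
    exact h2.comp x₀ hTs
  have h2 : ContDiffAt ℝ n (fun x => -(ContinuousLinearMap.snd ℝ F F ∘L (T x).inverse)) x₀ :=
    (contDiffAt_const.clm_comp h1).neg
  refine h2.congr_of_eventuallyEq ?_
  filter_upwards [hinv] with x ⟨e, he, hes⟩
  rw [← he, ContinuousLinearMap.inverse_equiv]
  ext v
  simp [hes]

end MovingFrame

/-! ### Real and complex traces of a complex linear endomorphism -/

section ComplexTrace

variable {V W : Type*} [AddCommGroup V] [Module ℝ V] [FiniteDimensional ℝ V]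
  [AddCommGroup W] [Module ℝ W] [FiniteDimensional ℝ W]

theorem complexModule_smul (J : V →ₗ[ℝ] V) (hJ : ∀ v, J (J v) = -v) (z : ℂ) (v : V) :
    letI := complexModule J hJ
    z • v = z.re • v + z.im • J v := by
  change (Complex.lift ⟨(J : Module.End ℝ V), by ext v; simp [hJ]⟩ z : Module.End ℝ V) v = _
  simp [Complex.lift_apply, Complex.liftAux_apply]

open TensorProduct in
/-- The complex trace of an endomorphism which commutes with `J`, in terms of a totally real
plane `Φ : W → V` and of the map `Q = J π_J : V → W`. -/
theorem exists_hasComplexTrace {J : V →ₗ[ℝ] V} (hJ : ∀ v, J (J v) = -v) {Φ : W →ₗ[ℝ] V}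
    {Q : V →ₗ[ℝ] W} (hQΦ : ∀ w, Q (Φ w) = 0) (hQJΦ : ∀ w, Q (J (Φ w)) = -w)
    (hid : ∀ v, v = -Φ (Q (J v)) - J (Φ (Q v))) {R : V →ₗ[ℝ] V} (hR : ∀ v, R (J v) = J (R v)) :
    ∃ t : ℂ, HasComplexTrace J hJ R t ∧ LinearMap.trace ℝ W (Q ∘ₗ R ∘ₗ Φ) = -t.im ∧
      LinearMap.trace ℝ V R = 2 * t.re ∧ LinearMap.trace ℝ V (J ∘ₗ R) = -(2 * t.im) := by
  -- Composing `S` with the splitting `hid` writes it as a sum of two maps that factor through `W`.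
  -- Cyclicity of the trace moves both to `W`, where they have the same trace because `S` commutes
  -- with `J`. This is used for `R` and for `J R`.
  have htr : ∀ S : V →ₗ[ℝ] V, (∀ v, S (J v) = J (S v)) →
      LinearMap.trace ℝ V S = -2 * LinearMap.trace ℝ W (Q ∘ₗ J ∘ₗ S ∘ₗ Φ) := by
    intro S hS
    have e : S = -((S ∘ₗ Φ) ∘ₗ (Q ∘ₗ J)) - ((S ∘ₗ J ∘ₗ Φ) ∘ₗ Q) := by
      ext v
      conv_lhs => rw [hid v]
      simp
    have e1 : (Q ∘ₗ J) ∘ₗ (S ∘ₗ Φ) = Q ∘ₗ J ∘ₗ S ∘ₗ Φ := rfl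
    have e2 : Q ∘ₗ (S ∘ₗ J ∘ₗ Φ) = Q ∘ₗ J ∘ₗ S ∘ₗ Φ := by
      ext w
      simp [hS]
    conv_lhs => rw [e]
    rw [map_sub, map_neg, LinearMap.trace_comp_comm' (Q ∘ₗ J) (S ∘ₗ Φ),
      LinearMap.trace_comp_comm' Q (S ∘ₗ J ∘ₗ Φ), e1, e2]
    ring
  let : Module ℂ V := complexModule J hJ
  have hsmul : ∀ (z : ℂ) (v : V), z • v = z.re • v + z.im • J v := complexModule_smul J hJ
  have : IsScalarTower ℝ ℂ V := ⟨fun a z v => by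
    rw [hsmul, hsmul]
    simp [smul_smul]⟩
  -- `A` and `B` are the real and imaginary parts of the complex matrix of `R`: the splitting of `R
  -- (Φ w)` reads `Φ (A w) + J (Φ (B w))`.
  set A : W →ₗ[ℝ] W := -(Q ∘ₗ J ∘ₗ R ∘ₗ Φ) with hA
  set B : W →ₗ[ℝ] W := -(Q ∘ₗ R ∘ₗ Φ) with hB
  -- A totally real plane of half dimension is a real form: the complex linear extension of `Φ` is
  -- an isomorphism, which carries `A + i B` to `R`.
  set Ψ : ℂ ⊗[ℝ] W →ₗ[ℂ] V := Φ.liftBaseChange ℂ with hΨ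
  have hΨ' : ∀ (z : ℂ) (w : W), Ψ (z ⊗ₜ w) = z.re • Φ w + z.im • J (Φ w) := by
    intro z w
    rw [hΨ, LinearMap.liftBaseChange_tmul, hsmul]
  have hbij : Function.Bijective Ψ := by
    refine ⟨Function.LeftInverse.injective
      (g := fun v => (1 : ℂ) ⊗ₜ (-Q (J v)) + Complex.I ⊗ₜ (-Q v)) ?_, fun v => ?_⟩
    · intro x
      induction x with
      | zero => simp
      | tmul z w =>
        rw [hΨ']
        simp only [map_add, map_smul, hJ, hQΦ, hQJΦ, map_neg]
        simp only [smul_zero, neg_zero, zero_add, smul_neg, neg_neg, add_zero,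
          TensorProduct.tmul_smul,
          TensorProduct.smul_tmul']
        rw [← TensorProduct.add_tmul]
        congr 1
        apply Complex.ext <;> simp
      | add x y hx hy =>
        rw [map_add]
        conv_rhs => rw [← hx, ← hy]
        simp only [map_add, neg_add, TensorProduct.tmul_add]
        abel
    · refine ⟨(1 : ℂ) ⊗ₜ (-Q (J v)) + Complex.I ⊗ₜ (-Q v), ?_⟩
      rw [map_add, hΨ', hΨ']
      conv_rhs => rw [hid v]
      simp
      abel
  set e : ℂ ⊗[ℝ] W ≃ₗ[ℂ] V := LinearEquiv.ofBijective Ψ hbij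
  have hI : ∀ v : V, Complex.I • v = J v := fun v => by rw [hsmul]; simp
  let R' : V →ₗ[ℂ] V :=
    { toFun := R
      map_add' := R.map_add
      map_smul' := fun z v => by simp [hsmul, hR] }
  set N : ℂ ⊗[ℝ] W →ₗ[ℂ] ℂ ⊗[ℝ] W := A.baseChange ℂ + Complex.I • B.baseChange ℂ with hN
  have hconj : R' = e.conj N := by
    have h1 : R' ∘ₗ e.toLinearMap = e.toLinearMap ∘ₗ N := by
      ext w
      change R (Ψ (1 ⊗ₜ w)) = Ψ (N (1 ⊗ₜ w))
      simp only [hN, LinearMap.add_apply, LinearMap.smul_apply, LinearMap.baseChange_tmul, map_add,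
        map_smul, hI, hΨ']
      simp only [Complex.one_re, Complex.one_im, one_smul, zero_smul, add_zero]
      conv_lhs => rw [hid (R (Φ w))]
      simp [hA, hB]
      abel
    ext v
    have h2 := congrArg (fun f => f (e.symm v)) h1
    simpa [LinearEquiv.conj_apply] using h2
  refine ⟨LinearMap.trace ℝ W A + Complex.I * LinearMap.trace ℝ W B, ⟨R', fun v => rfl, ?_⟩,
    ?_, ?_, ?_⟩
  · rw [hconj, LinearMap.trace_conj', hN, map_add, map_smul, LinearMap.trace_baseChange,
      LinearMap.trace_baseChange]
    rfl
  · simp [hB]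
  · rw [htr R hR]
    simp [hA]
  · rw [htr (J ∘ₗ R) (by simp [hR])]
    have e3 : Q ∘ₗ J ∘ₗ (J ∘ₗ R) ∘ₗ Φ = B := by
      ext w
      simp [hB, hJ]
    rw [e3]
    simp

/-- The trace of an endomorphism in an orthonormal basis of a bilinear form. -/
theorem trace_eq_sum_of_orthonormal {ι : Type*} [Fintype ι] [DecidableEq ι] (e : Basis ι ℝ V)
    (G : V →ₗ[ℝ] V →ₗ[ℝ] ℝ) (hG : ∀ i j, G (e i) (e j) = if i = j then 1 else 0)
    (A : V →ₗ[ℝ] V) : LinearMap.trace ℝ V A = ∑ j, G (A (e j)) (e j) := by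
  rw [LinearMap.trace_eq_matrix_trace ℝ e, Matrix.trace]
  refine Finset.sum_congr rfl fun j _ => ?_
  rw [Matrix.diag_apply, LinearMap.toMatrix_apply]
  have h : G (A (e j)) (e j) = G (∑ i, e.repr (A (e j)) i • e i) (e j) := by rw [e.sum_repr]
  rw [h, map_sum, LinearMap.sum_apply]
  simp [hG]

end ComplexTrace

section Charts

variable {E : Type*} [NormedAddCommGroup E] [NormedSpace ℝ E]
  {M : Type*} [TopologicalSpace M] [ChartedSpace E M] [IsManifold 𝓘(ℝ, E) ∞ M]
  {F : Type*} [NormedAddCommGroup F] [NormedSpace ℝ F]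
  {L : Type*} [TopologicalSpace L] [ChartedSpace F L] [IsManifold 𝓘(ℝ, F) ∞ L]

/-! ### Tangent vectors, derivatives and smoothness in a fixed chart -/

section Coordinates

/-- The coordinates of a tangent vector at `y` in the chart centred at `x₀`. -/
def coord (x₀ y : M) : TangentSpace 𝓘(ℝ, E) y →L[ℝ] E :=
  (trivializationAt E (TangentSpace 𝓘(ℝ, E)) x₀).continuousLinearMapAt ℝ y

/-- The tangent vector at `y` with given coordinates in the chart centred at `x₀`. -/
def ofCoord (x₀ y : M) : E →L[ℝ] TangentSpace 𝓘(ℝ, E) y :=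
  (trivializationAt E (TangentSpace 𝓘(ℝ, E)) x₀).symmL ℝ y

theorem coord_ofCoord {x₀ y : M} (hy : y ∈ (chartAt E x₀).source) (c : E) :
    coord x₀ y (ofCoord x₀ y c) = c :=
  Trivialization.continuousLinearMapAt_symmL (R := ℝ)
    (trivializationAt E (TangentSpace 𝓘(ℝ, E)) x₀) hy c

theorem ofCoord_coord {x₀ y : M} (hy : y ∈ (chartAt E x₀).source) (v : TangentSpace 𝓘(ℝ, E) y) :
    ofCoord x₀ y (coord x₀ y v) = v :=
  Trivialization.symmL_continuousLinearMapAt (R := ℝ)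
    (trivializationAt E (TangentSpace 𝓘(ℝ, E)) x₀) hy v

theorem coord_apply {x₀ y : M} (hy : y ∈ (chartAt E x₀).source) (v : TangentSpace 𝓘(ℝ, E) y) :
    coord x₀ y v = (trivializationAt E (TangentSpace 𝓘(ℝ, E)) x₀ ⟨y, v⟩).2 :=
  Trivialization.continuousLinearMapAt_apply_of_mem (R := ℝ)
    (trivializationAt E (TangentSpace 𝓘(ℝ, E)) x₀) hy v

theorem extend_eq_ofCoord {x₀ y : M} (hy : y ∈ (chartAt E x₀).source)
    (v : TangentSpace 𝓘(ℝ, E) x₀) :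
    (extend E v : ∀ y : M, TangentSpace 𝓘(ℝ, E) y) y = ofCoord x₀ y (coord x₀ x₀ v) := by
  rw [extend, coord_apply (mem_chart_source E x₀) v]
  exact (Trivialization.symmL_apply (R := ℝ)
    (trivializationAt E (TangentSpace 𝓘(ℝ, E)) x₀) hy _).symm

theorem chart_source_mem_nhds {x₀ y : M} (hy : y ∈ (chartAt E x₀).source) :
    (chartAt E x₀).source ∈ 𝓝 y :=
  (chartAt E x₀).open_source.mem_nhds hy

/-- A vector field along a map is differentiable when its coordinates are. -/
theorem mdifferentiableAt_mk_iff {x₀ : M} {f : L → M} {Y : ∀ q : L, TangentSpace 𝓘(ℝ, E) (f q)}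
    {q : L} (hq : f q ∈ (chartAt E x₀).source) :
    MDifferentiableAt 𝓘(ℝ, F) (𝓘(ℝ, E).prod 𝓘(ℝ, E))
      (fun q => TotalSpace.mk' E (f q) (Y q)) q ↔
    MDifferentiableAt 𝓘(ℝ, F) 𝓘(ℝ, E) f q ∧
      MDifferentiableAt 𝓘(ℝ, F) 𝓘(ℝ, E) (fun q => coord x₀ (f q) (Y q)) q := by
  rw [(trivializationAt E (TangentSpace 𝓘(ℝ, E)) x₀).mdifferentiableAt_totalSpace_iff 𝓘(ℝ, E) _
    (by rw [Trivialization.mem_source]; exact hq)]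
  refine and_congr_right fun hf => ?_
  refine Filter.EventuallyEq.mdifferentiableAt_iff ?_
  filter_upwards [hf.continuousAt.preimage_mem_nhds (chart_source_mem_nhds hq)] with q' hq'
  exact (coord_apply hq' _).symm

theorem mdifferentiableAt_ofCoord {x₀ y : M} (hy : y ∈ (chartAt E x₀).source) (c : E) :
    MDiffAt (T% (fun y => ofCoord x₀ y c)) y := by
  refine (mdifferentiableAt_mk_iff (f := id) (x₀ := x₀) hy).2 ⟨mdifferentiableAt_id, ?_⟩
  refine (mdifferentiableAt_const (c := c)).congr_of_eventuallyEq ?_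
  filter_upwards [chart_source_mem_nhds hy] with y' hy'
  exact coord_ofCoord hy' c

theorem contMDiffAt_ofCoord {x₀ y : M} (hy : y ∈ (chartAt E x₀).source) (c : E) :
    CMDiffAt ∞ (T% (fun y => ofCoord x₀ y c)) y := by
  rw [← contMDiffWithinAt_univ,
    (trivializationAt E (TangentSpace 𝓘(ℝ, E)) x₀).contMDiffWithinAt_section _ hy,
    contMDiffWithinAt_univ]
  refine (contMDiffAt_const (c := c)).congr_of_eventuallyEq ?_
  filter_upwards [chart_source_mem_nhds hy] with y' hy'
  exact (coord_apply hy' _).symm.trans (coord_ofCoord hy' c)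

theorem eventuallyEq_comp_extChartAt {X : Type*} {x₀ y : M} (hy : y ∈ (chartAt E x₀).source)
    (a : M → X) : a =ᶠ[𝓝 y] (a ∘ (extChartAt 𝓘(ℝ, E) x₀).symm) ∘ (extChartAt 𝓘(ℝ, E) x₀) := by
  filter_upwards [chart_source_mem_nhds hy] with z hz
  simp only [Function.comp_apply]
  rw [(extChartAt 𝓘(ℝ, E) x₀).left_inv (by simpa using hz)]

theorem mdifferentiableAt_of_chart {X : Type*} [NormedAddCommGroup X] [NormedSpace ℝ X] {x₀ y : M}
    (hy : y ∈ (chartAt E x₀).source) {a : M → X}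
    (ha : DifferentiableAt ℝ (a ∘ (extChartAt 𝓘(ℝ, E) x₀).symm) (extChartAt 𝓘(ℝ, E) x₀ y)) :
    MDifferentiableAt 𝓘(ℝ, E) 𝓘(ℝ, X) a y :=
  (ha.mdifferentiableAt.comp y
    (mdifferentiableAt_extChartAt (I := 𝓘(ℝ, E)) hy)).congr_of_eventuallyEq
    (eventuallyEq_comp_extChartAt hy a)

theorem mvfderiv_congr {X : Type*} [NormedAddCommGroup X] [NormedSpace ℝ X] {y : M} {a b : M → X}
    (h : a =ᶠ[𝓝 y] b) (u : TangentSpace 𝓘(ℝ, E) y) :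
    mvfderiv 𝓘(ℝ, E) a y u = mvfderiv 𝓘(ℝ, E) b y u :=
  congrArg (fun A : E →L[ℝ] X => A u) (h.mfderiv_eq (I := 𝓘(ℝ, E)) (I' := 𝓘(ℝ, X)))

/-- The derivative of a function given in a chart. -/
theorem mvfderiv_comp_extChartAt {X : Type*} [NormedAddCommGroup X] [NormedSpace ℝ X] {x₀ y : M}
    (hy : y ∈ (chartAt E x₀).source) {b : E → X}
    (hb : DifferentiableAt ℝ b (extChartAt 𝓘(ℝ, E) x₀ y)) (u : TangentSpace 𝓘(ℝ, E) y) :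
    mvfderiv 𝓘(ℝ, E) (fun y => b (extChartAt 𝓘(ℝ, E) x₀ y)) y u =
      fderiv ℝ b (extChartAt 𝓘(ℝ, E) x₀ y) (coord x₀ y u) := by
  rw [coord, TangentBundle.continuousLinearMapAt_trivializationAt hy]
  have h1 := mfderiv_comp (I := 𝓘(ℝ, E)) (I' := 𝓘(ℝ, E)) (I'' := 𝓘(ℝ, X)) y
    hb.mdifferentiableAt (mdifferentiableAt_extChartAt (I := 𝓘(ℝ, E)) hy)
  rw [mfderiv_eq_fderiv] at h1
  exact congrArg (fun A : E →L[ℝ] X => A u) h1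

/-- The derivative of a function, computed in a chart. -/
theorem mvfderiv_eq_fderiv {X : Type*} [NormedAddCommGroup X] [NormedSpace ℝ X] {x₀ y : M}
    (hy : y ∈ (chartAt E x₀).source) {a : M → X}
    (ha : DifferentiableAt ℝ (a ∘ (extChartAt 𝓘(ℝ, E) x₀).symm) (extChartAt 𝓘(ℝ, E) x₀ y))
    (u : TangentSpace 𝓘(ℝ, E) y) :
    mvfderiv 𝓘(ℝ, E) a y u =
      fderiv ℝ (a ∘ (extChartAt 𝓘(ℝ, E) x₀).symm) (extChartAt 𝓘(ℝ, E) x₀ y) (coord x₀ y u) :=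
  (mvfderiv_congr (eventuallyEq_comp_extChartAt hy a) u).trans (mvfderiv_comp_extChartAt hy ha u)

theorem differentiableAt_comp_extChartAt_symm {X : Type*} [NormedAddCommGroup X] [NormedSpace ℝ X]
    {x₀ : M} {a : M → X} (ha : MDifferentiableAt 𝓘(ℝ, E) 𝓘(ℝ, X) a x₀) :
    DifferentiableAt ℝ (a ∘ (extChartAt 𝓘(ℝ, E) x₀).symm) (extChartAt 𝓘(ℝ, E) x₀ x₀) := by
  have h : DifferentiableWithinAt ℝ (a ∘ (extChartAt 𝓘(ℝ, E) x₀).symm) (Set.range 𝓘(ℝ, E))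
    (extChartAt 𝓘(ℝ, E) x₀ x₀) := ((mdifferentiableAt_iff _ _).1 ha).2
  rwa [modelWithCornersSelf_coe, Set.range_id, differentiableWithinAt_univ] at h

theorem contDiffAt_comp_extChartAt_symm {X : Type*} [NormedAddCommGroup X] [NormedSpace ℝ X]
    {n : WithTop ℕ∞} {x₀ : M} {a : M → X} (ha : ContMDiffAt 𝓘(ℝ, E) 𝓘(ℝ, X) n a x₀) :
    ContDiffAt ℝ n (a ∘ (extChartAt 𝓘(ℝ, E) x₀).symm) (extChartAt 𝓘(ℝ, E) x₀ x₀) := by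
  have h : ContDiffWithinAt ℝ n (a ∘ (extChartAt 𝓘(ℝ, E) x₀).symm) (Set.range 𝓘(ℝ, E))
    (extChartAt 𝓘(ℝ, E) x₀ x₀) := (contMDiffAt_iff.1 ha).2
  rwa [modelWithCornersSelf_coe, Set.range_id, contDiffWithinAt_univ] at h

theorem eventually_extChartAt_symm {x₀ : M} {p : M → Prop} (h : ∀ᶠ y in 𝓝 x₀, p y) :
    ∀ᶠ z in 𝓝 (extChartAt 𝓘(ℝ, E) x₀ x₀), p ((extChartAt 𝓘(ℝ, E) x₀).symm z) :=
  (continuousAt_extChartAt_symm x₀).eventually (by rwa [extChartAt_to_inv])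

theorem eventually_extChartAt {x₀ : M} {p : E → Prop}
    (h : ∀ᶠ z in 𝓝 (extChartAt 𝓘(ℝ, E) x₀ x₀), p z) :
    ∀ᶠ y in 𝓝 x₀, p (extChartAt 𝓘(ℝ, E) x₀ y) :=
  (continuousAt_extChartAt x₀).eventually h

/-- A smooth function on `M` is differentiable in the chart, near the centre of the chart. -/
theorem eventually_differentiableAt_chart {X : Type*} [NormedAddCommGroup X] [NormedSpace ℝ X]
    {x₀ : M} {a : M → X} (ha : ContMDiffAt 𝓘(ℝ, E) 𝓘(ℝ, X) ∞ a x₀) :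
    ∀ᶠ y in 𝓝 x₀, DifferentiableAt ℝ (a ∘ (extChartAt 𝓘(ℝ, E) x₀).symm)
      (extChartAt 𝓘(ℝ, E) x₀ y) := by
  refine eventually_extChartAt ?_
  have h := ((contDiffAt_comp_extChartAt_symm ha).of_le
    (m := 1) (by norm_num)).eventually (by simp)
  filter_upwards [h] with z hz using hz.differentiableAt one_ne_zero

theorem contMDiffAt_comp_extChartAt {X : Type*} [NormedAddCommGroup X] [NormedSpace ℝ X]
    {x₀ : M} {b : E → X} {n : WithTop ℕ∞} (hn : n ≤ ∞)
    (hb : ContDiffAt ℝ n b (extChartAt 𝓘(ℝ, E) x₀ x₀)) :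
    ContMDiffAt 𝓘(ℝ, E) 𝓘(ℝ, X) n (fun y => b (extChartAt 𝓘(ℝ, E) x₀ y)) x₀ :=
  hb.contMDiffAt.comp x₀ ((contMDiffAt_extChartAt (n := ∞)).of_le hn)

end Coordinates

variable [FiniteDimensional ℝ E] [T2Space M] [FiniteDimensional ℝ F]

/-! ### The pull-back connection in a fixed chart -/

section PullbackConnection

theorem pullbackCov_congr (D : Connection E M) {f : L → M}
    {Y Y' : ∀ q : L, TangentSpace 𝓘(ℝ, E) (f q)} {p : L} (h : ∀ᶠ q in 𝓝 p, Y q = Y' q) :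
    pullbackCov (F := F) D f Y p = pullbackCov D f Y' p := by
  have h1 : (fun q => (trivializationAt E (TangentSpace 𝓘(ℝ, E)) (f p)).continuousLinearMapAt ℝ
      (f q) (Y q)) =ᶠ[𝓝 p] fun q => (trivializationAt E (TangentSpace 𝓘(ℝ, E))
        (f p)).continuousLinearMapAt ℝ (f q) (Y' q) := by
    filter_upwards [h] with q hq
    rw [hq]
  have h2 := h1.mfderiv_eq (I := 𝓘(ℝ, F)) (I' := 𝓘(ℝ, E))
  simp only [pullbackCov, h.self_of_nhds, mvfderiv, h2]
  rfl

/-- Leibniz rule for sections expanded in a frame of `TM`. Differentiability is proved together with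
the formula because `pullbackCov_add` needs it at each step of the induction. -/
theorem pullbackCov_sum_smul (D : Connection E M) {f : L → M} {p : L}
    (hf : MDifferentiableAt 𝓘(ℝ, F) 𝓘(ℝ, E) f p) {κ : Type*} (s : Finset κ) {a : κ → L → ℝ}
    (ha : ∀ k, MDifferentiableAt 𝓘(ℝ, F) 𝓘(ℝ) (a k) p)
    {Z : κ → ∀ y : M, TangentSpace 𝓘(ℝ, E) y} (hZ : ∀ k, MDiffAt (T% (Z k)) (f p))
    (u : TangentSpace 𝓘(ℝ, F) p) :
    MDifferentiableAt 𝓘(ℝ, F) (𝓘(ℝ, E).prod 𝓘(ℝ, E))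
      (fun q => TotalSpace.mk' E (f q) (∑ k ∈ s, a k q • Z k (f q))) p ∧
    pullbackCov D f (fun q => ∑ k ∈ s, a k q • Z k (f q)) p u =
      ∑ k ∈ s, (a k p • D (Z k) (f p) (mfderiv 𝓘(ℝ, F) 𝓘(ℝ, E) f p u) +
        mvfderiv 𝓘(ℝ, F) (a k) p u • Z k (f p)) := by
  classical
  have hx := mem_chart_source E (f p)
  have hZf : ∀ k, MDifferentiableAt 𝓘(ℝ, F) (𝓘(ℝ, E).prod 𝓘(ℝ, E))
      (fun q => TotalSpace.mk' E (f q) (Z k (f q))) p :=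
    fun k => MDifferentiableAt.comp p (hZ k) hf
  have haZ : ∀ k, MDifferentiableAt 𝓘(ℝ, F) (𝓘(ℝ, E).prod 𝓘(ℝ, E))
      (fun q => TotalSpace.mk' E (f q) (a k q • Z k (f q))) p := fun k => by
    rw [mdifferentiableAt_mk_iff hx]
    refine ⟨hf, ?_⟩
    simp only [map_smul]
    exact (ha k).smul ((mdifferentiableAt_mk_iff hx).1 (hZf k)).2
  induction s using Finset.induction_on with
  | empty =>
    have h0 : MDifferentiableAt 𝓘(ℝ, F) (𝓘(ℝ, E).prod 𝓘(ℝ, E))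
        (fun q => TotalSpace.mk' E (f q) (0 : TangentSpace 𝓘(ℝ, E) (f q))) p := by
      rw [mdifferentiableAt_mk_iff hx]
      refine ⟨hf, ?_⟩
      simp only [map_zero]
      exact mdifferentiableAt_const
    -- The zero section is differentiated as zero times itself.
    have h1 := pullbackCov_smul (F := F) D (a := fun _ => (0 : ℝ)) mdifferentiableAt_const h0 u
    simp only [smul_zero, zero_smul, zero_add] at h1
    simpa using ⟨h0, h1⟩
  | insert k s hk ih =>
    simp only [Finset.sum_insert hk]
    have h1 := (mdifferentiableAt_mk_iff hx).1 (haZ k)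
    have h2 := (mdifferentiableAt_mk_iff hx).1 ih.1
    refine ⟨?_, ?_⟩
    · rw [mdifferentiableAt_mk_iff hx]
      refine ⟨hf, ?_⟩
      simp only [map_add]
      exact h1.2.add h2.2
    · rw [pullbackCov_add D (haZ k) ih.1, ← ih.2, ← pullbackCov_comp D hf (hZ k),
        ← pullbackCov_smul D (ha k) (hZf k)]
      rfl

/-- The connection form of `D` in the chart centred at `x₀`: in coordinates,
`∇_u Y = dY(u) + christoffel u Y`. -/
def christoffel (D : Connection E M) (x₀ y : M) : E →L[ℝ] E →L[ℝ] E :=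
  ∑ k, (ContinuousLinearMap.smulRightL ℝ E E
      (LinearMap.toContinuousLinearMap ((finBasis ℝ E).coord k))).comp
    ((coord x₀ y).comp ((D (fun y => ofCoord x₀ y (finBasis ℝ E k)) y).comp (ofCoord x₀ y)))

theorem christoffel_apply (D : Connection E M) (x₀ y : M) (u c : E) :
    christoffel D x₀ y u c = ∑ k, (finBasis ℝ E).coord k c •
      coord x₀ y (D (fun y => ofCoord x₀ y (finBasis ℝ E k)) y (ofCoord x₀ y u)) := by
  simp [christoffel]

/-- `pullbackCov` at `q` is defined with the trivialization centred at `f q`, which varies with `q`.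
Expanding `Y` in the coordinate frame of one chart gives a formula valid at all `q` mapped into that
chart, which can therefore be differentiated in `q`. -/
theorem coord_pullbackCov (D : Connection E M) {f : L → M} {x₀ : M} {q : L}
    (hq : f q ∈ (chartAt E x₀).source) {Y : ∀ q : L, TangentSpace 𝓘(ℝ, E) (f q)}
    (hY : MDifferentiableAt 𝓘(ℝ, F) (𝓘(ℝ, E).prod 𝓘(ℝ, E))
      (fun q => TotalSpace.mk' E (f q) (Y q)) q) (u : TangentSpace 𝓘(ℝ, F) q) :
    coord x₀ (f q) (pullbackCov D f Y q u) =
      mvfderiv 𝓘(ℝ, F) (fun q => coord x₀ (f q) (Y q)) q u +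
        christoffel D x₀ (f q) (coord x₀ (f q) (mfderiv 𝓘(ℝ, F) 𝓘(ℝ, E) f q u))
          (coord x₀ (f q) (Y q)) := by
  obtain ⟨hf, hy⟩ := (mdifferentiableAt_mk_iff hq).1 hY
  set y : L → E := fun q => coord x₀ (f q) (Y q) with hydef
  set b := finBasis ℝ E with hb
  have ha : ∀ k, MDifferentiableAt 𝓘(ℝ, F) 𝓘(ℝ) (fun q => b.coord k (y q)) q := fun k =>
    ((LinearMap.toContinuousLinearMap (b.coord k)).mdifferentiableAt (x := y q)).comp q hy
  have h1 := (pullbackCov_sum_smul D hf Finset.univ (a := fun k q => b.coord k (y q)) ha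
    (Z := fun k y => ofCoord x₀ y (b k)) (fun k => mdifferentiableAt_ofCoord hq (b k)) u).2
  have h2 : ∀ᶠ q' in 𝓝 q, Y q' = ∑ k, b.coord k (y q') • ofCoord x₀ (f q') (b k) := by
    filter_upwards [hf.continuousAt.preimage_mem_nhds (chart_source_mem_nhds hq)] with q' hq'
    rw [← ofCoord_coord hq' (Y q')]
    conv_lhs => rw [← b.sum_repr (coord x₀ (f q') (Y q')), map_sum]
    simp [hydef]
  rw [pullbackCov_congr D h2, h1]
  simp only [map_sum, map_add, map_smul, coord_ofCoord hq, Finset.sum_add_distrib]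
  rw [add_comm, christoffel_apply]
  simp only [ofCoord_coord hq]
  congr 1
  have h3 : ∀ k, mvfderiv 𝓘(ℝ, F) (fun q => b.coord k (y q)) q u =
      b.coord k (mvfderiv 𝓘(ℝ, F) y q u) := by
    intro k
    have h4 := mfderiv_comp (I := 𝓘(ℝ, F)) (I' := 𝓘(ℝ, E)) (I'' := 𝓘(ℝ)) q
      ((LinearMap.toContinuousLinearMap (b.coord k)).mdifferentiableAt (x := y q)) hy
    rw [ContinuousLinearMap.mfderiv_eq] at h4
    have h5 := congrArg (fun A : F →L[ℝ] ℝ => A u) h4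
    exact h5
  simp only [h3]
  exact b.sum_repr _

end PullbackConnection

end Charts

/-! ### Lie brackets, connection form and curvature in a chart -/

section ChartConnection

variable {E : Type*} [NormedAddCommGroup E] [NormedSpace ℝ E]
  {M : Type*} [TopologicalSpace M] [ChartedSpace E M] [IsManifold 𝓘(ℝ, E) ∞ M]
  [FiniteDimensional ℝ E]

section LieBracket

/-- The derivative of the inverse chart is `ofCoord`, so pulling back by it inverts `ofCoord`, that
is, takes coordinates. -/
theorem coord_comp_extChartAt_symm_eq (p : M) (X : ∀ y : M, TangentSpace 𝓘(ℝ, E) y) {z : E}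
    (hz : z ∈ (extChartAt 𝓘(ℝ, E) p).target) :
    mpullbackWithin 𝓘(ℝ, E) 𝓘(ℝ, E) (extChartAt 𝓘(ℝ, E) p).symm X (Set.range 𝓘(ℝ, E)) z =
      coord p ((extChartAt 𝓘(ℝ, E) p).symm z) (X ((extChartAt 𝓘(ℝ, E) p).symm z)) := by
  have hs : (extChartAt 𝓘(ℝ, E) p).symm z ∈ (chartAt E p).source := by
    have := (extChartAt 𝓘(ℝ, E) p).map_target hz
    rwa [extChartAt_source] at this
  have h1 := TangentBundle.symmL_trivializationAt (I := 𝓘(ℝ, E)) hs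
  rw [(extChartAt 𝓘(ℝ, E) p).right_inv hz] at h1
  have h2 : (ofCoord p ((extChartAt 𝓘(ℝ, E) p).symm z)).inverse =
      coord p ((extChartAt 𝓘(ℝ, E) p).symm z) :=
    ContinuousLinearMap.inverse_eq (by ext v; exact ofCoord_coord hs v)
      (by ext v; exact coord_ofCoord hs v)
  rw [mpullbackWithin_apply, ← h1]
  exact congrArg (fun A : TangentSpace 𝓘(ℝ, E) ((extChartAt 𝓘(ℝ, E) p).symm z) →L[ℝ] E => A _) h2

/-- The Lie bracket of two vector fields in the chart. -/
theorem mlieBracket_eq (X Y : ∀ y : M, TangentSpace 𝓘(ℝ, E) y) (p : M) {X' Y' : E → E}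
    (hX : ∀ᶠ z in 𝓝 (extChartAt 𝓘(ℝ, E) p p), X' z =
      coord p ((extChartAt 𝓘(ℝ, E) p).symm z) (X ((extChartAt 𝓘(ℝ, E) p).symm z)))
    (hY : ∀ᶠ z in 𝓝 (extChartAt 𝓘(ℝ, E) p p), Y' z =
      coord p ((extChartAt 𝓘(ℝ, E) p).symm z) (Y ((extChartAt 𝓘(ℝ, E) p).symm z))) :
    coord p p (mlieBracket 𝓘(ℝ, E) X Y p) =
      fderiv ℝ Y' (extChartAt 𝓘(ℝ, E) p p) (X' (extChartAt 𝓘(ℝ, E) p p)) -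
        fderiv ℝ X' (extChartAt 𝓘(ℝ, E) p p) (Y' (extChartAt 𝓘(ℝ, E) p p)) := by
  have ht : ∀ᶠ z in 𝓝 (extChartAt 𝓘(ℝ, E) p p), z ∈ (extChartAt 𝓘(ℝ, E) p).target :=
    extChartAt_target_mem_nhds p
  have key : ∀ {Z : ∀ y : M, TangentSpace 𝓘(ℝ, E) y} {Z' : E → E},
      (∀ᶠ z in 𝓝 (extChartAt 𝓘(ℝ, E) p p), Z' z =
        coord p ((extChartAt 𝓘(ℝ, E) p).symm z) (Z ((extChartAt 𝓘(ℝ, E) p).symm z))) →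
      mpullbackWithin 𝓘(ℝ, E) 𝓘(ℝ, E) (extChartAt 𝓘(ℝ, E) p).symm Z (Set.range 𝓘(ℝ, E))
        =ᶠ[𝓝 (extChartAt 𝓘(ℝ, E) p p)] Z' := by
    intro Z Z' h
    filter_upwards [h, ht] with z hz hzt
    rw [hz]
    exact coord_comp_extChartAt_symm_eq p Z hzt
  have hX2 := key hX
  have hY2 := key hY
  have hu : (extChartAt 𝓘(ℝ, E) p).symm ⁻¹' Set.univ ∩ Set.range 𝓘(ℝ, E) = Set.univ := by simp
  have hp := mem_chart_source E p
  have h1 := TangentBundle.continuousLinearMapAt_trivializationAt (I := 𝓘(ℝ, E)) hp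
  have h2 : (coord p p).inverse = ofCoord p p :=
    ContinuousLinearMap.inverse_eq (ContinuousLinearMap.ext fun v => coord_ofCoord hp v)
      (ContinuousLinearMap.ext fun v => ofCoord_coord hp v)
  rw [← mlieBracketWithin_univ, mlieBracketWithin_apply, hu, ← h1]
  refine (congrArg (fun A : E →L[ℝ] TangentSpace 𝓘(ℝ, E) p => coord p p (A _)) h2).trans ?_
  refine (coord_ofCoord hp _).trans ?_
  refine (congrFun (lieBracketWithin_univ (𝕜 := ℝ)) (extChartAt 𝓘(ℝ, E) p p)).trans ?_
  have h3 : ∀ (V W : E → E) (z : E), lieBracket ℝ V W z =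
    fderiv ℝ W z (V z) - fderiv ℝ V z (W z) := fun _ _ _ => rfl
  refine (h3 _ _ _).trans ?_
  rw [hX2.fderiv_eq, hY2.fderiv_eq, hX2.self_of_nhds, hY2.self_of_nhds]

end LieBracket

/-- A property of the points of the chart may be checked on the manifold. -/
theorem eventually_chart_of_eventually {x₀ : M} {p : E → Prop}
    (h : ∀ᶠ y in 𝓝 x₀, p (extChartAt 𝓘(ℝ, E) x₀ y)) :
    ∀ᶠ z in 𝓝 (extChartAt 𝓘(ℝ, E) x₀ x₀), p z := by
  filter_upwards [eventually_extChartAt_symm h, extChartAt_target_mem_nhds (I := 𝓘(ℝ, E)) x₀]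
    with z hz hzt
  rwa [(extChartAt 𝓘(ℝ, E) x₀).right_inv hzt] at hz

variable [T2Space M]

/-- A connection is its own pull-back by the identity, so `coord_pullbackCov` applies with `f = id`.
-/
theorem coord_cov (D : Connection E M) {x₀ y : M} (hy : y ∈ (chartAt E x₀).source)
    {Z : ∀ y : M, TangentSpace 𝓘(ℝ, E) y} (hZ : MDiffAt (T% Z) y) (u : TangentSpace 𝓘(ℝ, E) y) :
    coord x₀ y (D Z y u) = mvfderiv 𝓘(ℝ, E) (fun y => coord x₀ y (Z y)) y u +
      christoffel D x₀ y (coord x₀ y u) (coord x₀ y (Z y)) := by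
  have h1 := pullbackCov_comp (F := E) (L := M) D (f := id) (p := y) mdifferentiableAt_id hZ u
  have h2 := coord_pullbackCov (F := E) (L := M) D (f := id) (q := y) hy
    (Y := fun q => Z q) hZ u
  rw [mfderiv_id] at h1 h2
  exact (congrArg (coord x₀ y) h1).symm.trans h2

theorem coord_cov_ofCoord (D : Connection E M) {x₀ y : M} (hy : y ∈ (chartAt E x₀).source)
    (c : E) (u : TangentSpace 𝓘(ℝ, E) y) :
    coord x₀ y (D (fun y => ofCoord x₀ y c) y u) = christoffel D x₀ y (coord x₀ y u) c := by
  rw [coord_cov D hy (mdifferentiableAt_ofCoord hy c), coord_ofCoord hy]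
  have h : (fun y => coord x₀ y (ofCoord x₀ y c)) =ᶠ[𝓝 y] fun _ => c := by
    filter_upwards [chart_source_mem_nhds hy] with y' hy' using coord_ofCoord hy' c
  have h2 := h.mfderiv_eq (I := 𝓘(ℝ, E)) (I' := 𝓘(ℝ, E))
  rw [mfderiv_const] at h2
  have h3 : mvfderiv 𝓘(ℝ, E) (fun y => coord x₀ y (ofCoord x₀ y c)) y u = 0 :=
    congrArg (fun A : E →L[ℝ] E => A u) h2
  rw [h3, zero_add]

/-- The covariant derivative of a vector field which is smooth near `x₀` is smooth at `x₀`. -/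
theorem contMDiffAt_cov_ofCoord (D : Connection E M) [hD : D.ContMDiffCovariantDerivative ∞]
    (x₀ : M) (c : E) :
    ContMDiffAt 𝓘(ℝ, E) (𝓘(ℝ, E).prod 𝓘(ℝ, E →L[ℝ] E)) ∞
      (fun y => TotalSpace.mk' (E →L[ℝ] E) (E := fun y : M => TangentSpace 𝓘(ℝ, E) y →L[ℝ]
        TangentSpace 𝓘(ℝ, E) y) y (D (fun y => ofCoord x₀ y c) y)) x₀ := by
  have hs := chart_source_mem_nhds (mem_chart_source E x₀)
  -- Smoothness of `D` is applied to a globally smooth section: the frame field is cut off by a bump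
  -- function equal to one near `x₀`, which does not change its covariant derivative there.
  obtain ⟨ψ, -, hψ⟩ := (SmoothBumpFunction.nhds_basis_tsupport (I := 𝓘(ℝ, E)) x₀).mem_iff.1 hs
  set W : ∀ y : M, TangentSpace 𝓘(ℝ, E) y := (ψ : M → ℝ) • fun y => ofCoord x₀ y c with hW
  have hWs : ContMDiff 𝓘(ℝ, E) (𝓘(ℝ, E).prod 𝓘(ℝ, E)) ∞ (T% W) :=
    ContMDiffOn.smul_section_of_tsupport ψ.contMDiff.contMDiffOn (chartAt E x₀).open_source hψ
      fun y hy => (contMDiffAt_ofCoord hy c).contMDiffWithinAt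
  have hcov := (hD.contMDiff.contMDiff (σ := W) (hWs.contMDiffOn)).contMDiffAt
    (x := x₀) Filter.univ_mem
  refine hcov.congr_of_eventuallyEq ?_
  filter_upwards [eventually_eventually_nhds.2 ψ.eventuallyEq_one, hs] with y hy hys
  have heq : D (fun y => ofCoord x₀ y c) y = D W y := by
    refine IsCovariantDerivativeOn.congr_of_eventuallyEq D.isCovariantDerivativeOnUniv
      (mdifferentiableAt_ofCoord hys c)
      ((hWs y).mdifferentiableAt (by simp)) Filter.univ_mem ?_
    filter_upwards [hy] with z hz
    simp [hW, hz]
  rw [heq]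

theorem contMDiffAt_christoffel (D : Connection E M) [D.ContMDiffCovariantDerivative ∞] (x₀ : M) :
    ContMDiffAt 𝓘(ℝ, E) 𝓘(ℝ, E →L[ℝ] E →L[ℝ] E) ∞ (christoffel D x₀) x₀ := by
  have h : ∀ k, ContMDiffAt 𝓘(ℝ, E) 𝓘(ℝ, E →L[ℝ] E) ∞ (fun y => (coord x₀ y).comp
      ((D (fun y => ofCoord x₀ y (finBasis ℝ E k)) y).comp (ofCoord x₀ y))) x₀ := fun k =>
    ((contMDiffAt_hom_bundle _).1 (contMDiffAt_cov_ofCoord D x₀ (finBasis ℝ E k))).2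
  unfold christoffel
  refine ContMDiffAt.sum fun k _ => ?_
  exact (ContMDiffAt.clm_comp contMDiffAt_const (h k))

/-- The connection form in the chart centred at `x₀`, as a function on the model space. -/
def chartConnection (D : Connection E M) (x₀ : M) : E → E →L[ℝ] E →L[ℝ] E :=
  christoffel D x₀ ∘ (extChartAt 𝓘(ℝ, E) x₀).symm

theorem contDiffAt_chartConnection (D : Connection E M) [D.ContMDiffCovariantDerivative ∞]
    (x₀ : M) : ContDiffAt ℝ ∞ (chartConnection D x₀) (extChartAt 𝓘(ℝ, E) x₀ x₀) :=
  contDiffAt_comp_extChartAt_symm (contMDiffAt_christoffel D x₀)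

theorem hasFDerivAt_chartConnection (D : Connection E M) [D.ContMDiffCovariantDerivative ∞]
    (x₀ : M) : HasFDerivAt (chartConnection D x₀)
      (fderiv ℝ (chartConnection D x₀) (extChartAt 𝓘(ℝ, E) x₀ x₀)) (extChartAt 𝓘(ℝ, E) x₀ x₀) :=
  ((contDiffAt_chartConnection D x₀).differentiableAt (by simp)).hasFDerivAt

theorem chartConnection_extChartAt (D : Connection E M) {x₀ y : M}
    (hy : y ∈ (chartAt E x₀).source) :
    chartConnection D x₀ (extChartAt 𝓘(ℝ, E) x₀ y) = christoffel D x₀ y := by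
  rw [chartConnection, Function.comp_apply, (extChartAt 𝓘(ℝ, E) x₀).left_inv (by simpa using hy)]

/-- The curvature `dΓ + Γ ∧ Γ` at the centre of the chart. -/
def chartCurvature (D : Connection E M) (x₀ : M) (u v : E) : E →L[ℝ] E :=
  fderiv ℝ (chartConnection D x₀) (extChartAt 𝓘(ℝ, E) x₀ x₀) u v -
      fderiv ℝ (chartConnection D x₀) (extChartAt 𝓘(ℝ, E) x₀ x₀) v u +
    (chartConnection D x₀ (extChartAt 𝓘(ℝ, E) x₀ x₀) u ∘L
        chartConnection D x₀ (extChartAt 𝓘(ℝ, E) x₀ x₀) v -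
      chartConnection D x₀ (extChartAt 𝓘(ℝ, E) x₀ x₀) v ∘L
        chartConnection D x₀ (extChartAt 𝓘(ℝ, E) x₀ x₀) u)

/-- The extensions used in `curvature` have constant coordinates near `x` in the chart centred at
`x`. Their bracket vanishes at `x`, and each iterated derivative is `∂_u Γ(v) w + Γ(u) Γ(v) w`. -/
theorem coord_curvature (D : Connection E M) [D.ContMDiffCovariantDerivative ∞]
    (x : M) (u v w : TangentSpace 𝓘(ℝ, E) x) :
    coord x x (curvature D x u v w) =
      chartCurvature D x (coord x x u) (coord x x v) (coord x x w) := by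
  have hx := mem_chart_source E x
  have hs := chart_source_mem_nhds hx
  have hext : ∀ w : TangentSpace 𝓘(ℝ, E) x, ∀ᶠ y in 𝓝 x,
      (extend E w : ∀ y : M, TangentSpace 𝓘(ℝ, E) y) y = ofCoord x y (coord x x w) := fun w => by
    filter_upwards [hs] with y hy using extend_eq_ofCoord hy w
  have hcov : ∀ v : TangentSpace 𝓘(ℝ, E) x, ∀ᶠ y in 𝓝 x, coord x y (D (extend E w) y
      ((extend E v : ∀ y : M, TangentSpace 𝓘(ℝ, E) y) y)) =
        christoffel D x y (coord x x v) (coord x x w) := by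
    intro v
    filter_upwards [eventually_eventually_nhds.2 (hext w), hext v, hs,
      eventually_mdifferentiableAt_extend x w] with y h1 h2 h3 h4
    have h5 : D (extend E w) y = D (fun y => ofCoord x y (coord x x w)) y :=
      D.isCovariantDerivativeOnUniv.congr_of_eventuallyEq h4
        (mdifferentiableAt_ofCoord h3 _) Filter.univ_mem h1
    rw [h5, h2, coord_cov_ofCoord D h3, coord_ofCoord h3]
  have hD2 : ∀ u v : TangentSpace 𝓘(ℝ, E) x, coord x x (D (fun y => D (extend E w) y
      ((extend E v : ∀ y : M, TangentSpace 𝓘(ℝ, E) y) y)) x u) =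
      fderiv ℝ (chartConnection D x) (extChartAt 𝓘(ℝ, E) x x) (coord x x u) (coord x x v)
          (coord x x w) +
        chartConnection D x (extChartAt 𝓘(ℝ, E) x x) (coord x x u)
          (chartConnection D x (extChartAt 𝓘(ℝ, E) x x) (coord x x v) (coord x x w)) := by
    intro u v
    have h1 := coord_cov D hx (mdifferentiableAt_cov_extend D x w
      (extend E v) (mdifferentiableAt_extend ..)) u
    rw [(hcov v).self_of_nhds] at h1
    have h2 := (Filter.EventuallyEq.mfderiv_eq (I := 𝓘(ℝ, E)) (I' := 𝓘(ℝ, E)) (hcov v))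
    have h3 : mvfderiv 𝓘(ℝ, E) (fun y => coord x y (D (extend E w) y
        ((extend E v : ∀ y : M, TangentSpace 𝓘(ℝ, E) y) y))) x u =
        mvfderiv 𝓘(ℝ, E) (fun y => christoffel D x y (coord x x v) (coord x x w)) x u :=
      congrArg (fun A : E →L[ℝ] E => A u) h2
    have h4 := ((hasFDerivAt_chartConnection D x).clm_apply
      (hasFDerivAt_const (coord x x v) _)).clm_apply (hasFDerivAt_const (coord x x w) _)
    have h5 := mvfderiv_eq_fderiv (a := fun y => christoffel D x y (coord x x v) (coord x x w)) hx
      h4.differentiableAt u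
    have h6 := congrArg (fun A : E →L[ℝ] E => A (coord x x u)) h4.fderiv
    rw [h1, h3, h5, ← chartConnection_extChartAt D hx]
    refine congrArg₂ (· + ·) (h6.trans ?_) rfl
    simp
  have hlie : mlieBracket 𝓘(ℝ, E) (extend E u) (extend E v) x = 0 := by
    have h : ∀ w : TangentSpace 𝓘(ℝ, E) x, ∀ᶠ z in 𝓝 (extChartAt 𝓘(ℝ, E) x x), coord x x w =
        coord x ((extChartAt 𝓘(ℝ, E) x).symm z) ((extend E w : ∀ y : M, TangentSpace 𝓘(ℝ, E) y)
          ((extChartAt 𝓘(ℝ, E) x).symm z)) := by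
      intro w
      filter_upwards [eventually_extChartAt_symm (hext w), eventually_extChartAt_symm hs]
        with z h1 h2
      rw [h1, coord_ofCoord h2]
    have h1 := mlieBracket_eq (extend E u) (extend E v) x (X' := fun _ => coord x x u)
      (Y' := fun _ => coord x x v) (h u) (h v)
    rw [← ofCoord_coord hx (mlieBracket 𝓘(ℝ, E) (extend E u) (extend E v) x), h1]
    simp
  change coord x x (curvatureFields D (extend E u) (extend E v) (extend E w) x) = _
  rw [curvatureFields, hlie, map_zero, sub_zero, extend_apply_self, extend_apply_self, map_sub,
    hD2, hD2]
  simp only [chartCurvature, _root_.add_apply, _root_.sub_apply, ContinuousLinearMap.comp_apply]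
  abel

/-! ### Curvature of a unitary connection: complex linear and skew-symmetric -/

section Unitary

/-- The almost complex structure in the chart centred at `x₀`. -/
def coordComplex (J : AlmostComplexStructure E M) (x₀ y : M) : E →L[ℝ] E :=
  (coord x₀ y).comp ((J.toFun y).comp (ofCoord x₀ y))

theorem contMDiffAt_coordComplex (J : AlmostComplexStructure E M) (x₀ : M) :
    ContMDiffAt 𝓘(ℝ, E) 𝓘(ℝ, E →L[ℝ] E) ∞ (coordComplex J x₀) x₀ :=
  ((contMDiffAt_hom_bundle _).1 (J.contMDiff x₀)).2

theorem coordComplex_coord (J : AlmostComplexStructure E M) {x₀ y : M}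
    (hy : y ∈ (chartAt E x₀).source) (v : TangentSpace 𝓘(ℝ, E) y) :
    coordComplex J x₀ y (coord x₀ y v) = coord x₀ y (J.toFun y v) := by
  simp [coordComplex, ofCoord_coord hy]

/-- The almost complex structure in the chart, as a function on the model space. -/
def chartComplex (J : AlmostComplexStructure E M) (x₀ : M) : E → E →L[ℝ] E :=
  coordComplex J x₀ ∘ (extChartAt 𝓘(ℝ, E) x₀).symm

theorem contDiffAt_chartComplex (J : AlmostComplexStructure E M) (x₀ : M) :
    ContDiffAt ℝ ∞ (chartComplex J x₀) (extChartAt 𝓘(ℝ, E) x₀ x₀) :=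
  contDiffAt_comp_extChartAt_symm (contMDiffAt_coordComplex J x₀)

theorem chartComplex_extChartAt (J : AlmostComplexStructure E M) {x₀ y : M}
    (hy : y ∈ (chartAt E x₀).source) :
    chartComplex J x₀ (extChartAt 𝓘(ℝ, E) x₀ y) = coordComplex J x₀ y := by
  rw [chartComplex, Function.comp_apply, (extChartAt 𝓘(ℝ, E) x₀).left_inv (by simpa using hy)]

/-- This is `∇J = 0` tested on fields with constant coordinates. It is needed on a neighbourhood,
since the proof that the curvature commutes with `J` differentiates it again. -/
theorem fderiv_chartComplex {D : Connection E M} {g : Metric E M} {J : AlmostComplexStructure E M}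
    (hD : IsUnitary D g J) (x₀ : M) :
    ∀ᶠ z in 𝓝 (extChartAt 𝓘(ℝ, E) x₀ x₀), ∀ u, fderiv ℝ (chartComplex J x₀) z u =
      chartComplex J x₀ z ∘L chartConnection D x₀ z u -
        chartConnection D x₀ z u ∘L chartComplex J x₀ z := by
  refine eventually_chart_of_eventually ?_
  have hsm := contMDiffAt_coordComplex J x₀
  filter_upwards [chart_source_mem_nhds (mem_chart_source E x₀),
    eventually_differentiableAt_chart hsm] with y hy hd u
  ext c
  have hJ : HasFDerivAt (chartComplex J x₀) (fderiv ℝ (chartComplex J x₀)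
    (extChartAt 𝓘(ℝ, E) x₀ y)) (extChartAt 𝓘(ℝ, E) x₀ y) := hd.hasFDerivAt
  have h1 := hD.complex y (ofCoord x₀ y u) _ (mdifferentiableAt_ofCoord (x₀ := x₀) hy c)
  have hJc : MDiffAt (T% (fun y => J.toFun y (ofCoord x₀ y c))) y := by
    refine (mdifferentiableAt_mk_iff (f := id) (x₀ := x₀) hy).2 ⟨mdifferentiableAt_id, ?_⟩
    exact (mdifferentiableAt_of_chart hy hd).clm_apply (mdifferentiableAt_const (c := c))
  have h2 := coord_cov D hy hJc (ofCoord x₀ y u)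
  have h3 := hJ.clm_apply (hasFDerivAt_const c _)
  have h4 := mvfderiv_eq_fderiv (a := fun y => coordComplex J x₀ y c) hy h3.differentiableAt
    (ofCoord x₀ y u)
  have h5 := congrArg (fun A : E →L[ℝ] E => A u) h3.fderiv
  have h6 : mvfderiv 𝓘(ℝ, E) (fun y => coord x₀ y (J.toFun y (ofCoord x₀ y c))) y
      (ofCoord x₀ y u) = fderiv ℝ (chartComplex J x₀) (extChartAt 𝓘(ℝ, E) x₀ y) u c := by
    refine h4.trans ?_
    rw [coord_ofCoord hy]
    refine h5.trans ?_
    simp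
  rw [h6, h1, coord_ofCoord hy, ← coordComplex_coord J hy, coord_cov_ofCoord D hy,
    coord_ofCoord hy, ← coordComplex_coord J hy, coord_ofCoord hy] at h2
  simp only [_root_.sub_apply, ContinuousLinearMap.comp_apply,
    chartComplex_extChartAt J hy, chartConnection_extChartAt D hy]
  rw [h2]
  simp

/-- The curvature of a unitary connection is complex linear. -/
theorem curvature_complex {D : Connection E M} [D.ContMDiffCovariantDerivative ∞] {g : Metric E M}
    {J : AlmostComplexStructure E M} (hD : IsUnitary D g J) (x : M)
    (u v w : TangentSpace 𝓘(ℝ, E) x) :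
    curvature D x u v (J.toFun x w) = J.toFun x (curvature D x u v w) := by
  have hx := mem_chart_source E x
  have h := flat_curvature_commute (hasFDerivAt_chartConnection D x) (contDiffAt_chartComplex J x)
    (fderiv_chartComplex hD x) (coord x x u) (coord x x v) (coord x x w)
  rw [← ofCoord_coord hx (curvature D x u v (J.toFun x w)), coord_curvature,
    ← coordComplex_coord J hx, ← chartComplex_extChartAt J hx, chartCurvature, h,
    chartComplex_extChartAt J hx, ← chartCurvature, ← coord_curvature, coordComplex_coord J hx,
    ofCoord_coord hx]

/-- The metric in the chart centred at `x₀`. -/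
def coordMetric (g : Metric E M) (x₀ y : M) : E →L[ℝ] E →L[ℝ] ℝ :=
  ContinuousLinearMap.inCoordinates E (fun x : M => TangentSpace 𝓘(ℝ, E) x) (E →L[ℝ] ℝ)
    (fun x : M => TangentSpace 𝓘(ℝ, E) x →L[ℝ] ℝ) x₀ y x₀ y (g.inner y)

theorem contMDiffAt_coordMetric (g : Metric E M) (x₀ : M) :
    ContMDiffAt 𝓘(ℝ, E) 𝓘(ℝ, E →L[ℝ] E →L[ℝ] ℝ) ∞ (coordMetric g x₀) x₀ :=
  ((contMDiffAt_hom_bundle _).1 (g.contMDiff x₀)).2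

theorem coordMetric_apply (g : Metric E M) {x₀ y : M} (hy : y ∈ (chartAt E x₀).source) (a b : E) :
    coordMetric g x₀ y a b = g.inner y (ofCoord x₀ y a) (ofCoord x₀ y b) := by
  have h := inCoordinates_apply_eq₂ (𝕜 := ℝ) (F₁ := E) (F₂ := E) (F₃ := ℝ)
    (E₁ := fun x : M => TangentSpace 𝓘(ℝ, E) x) (E₂ := fun x : M => TangentSpace 𝓘(ℝ, E) x)
    (E₃ := Bundle.Trivial M ℝ) (ϕ := g.inner y) (v := a) (w := b) hy hy (Set.mem_univ _)
  refine h.trans ?_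
  rw [← Trivialization.symmL_apply (R := ℝ) (trivializationAt E (TangentSpace 𝓘(ℝ, E)) x₀) hy,
    ← Trivialization.symmL_apply (R := ℝ) (trivializationAt E (TangentSpace 𝓘(ℝ, E)) x₀) hy]
  exact congrArg (fun A : ℝ →ₗ[ℝ] ℝ => A _)
    (Bundle.Trivial.linearMapAt_trivialization (𝕜 := ℝ) (B := M) (F := ℝ) y)

/-- The metric in the chart, as a function on the model space. -/
def chartMetric (g : Metric E M) (x₀ : M) : E → E →L[ℝ] E →L[ℝ] ℝ :=
  coordMetric g x₀ ∘ (extChartAt 𝓘(ℝ, E) x₀).symm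

theorem contDiffAt_chartMetric (g : Metric E M) (x₀ : M) :
    ContDiffAt ℝ ∞ (chartMetric g x₀) (extChartAt 𝓘(ℝ, E) x₀ x₀) :=
  contDiffAt_comp_extChartAt_symm (contMDiffAt_coordMetric g x₀)

theorem chartMetric_extChartAt (g : Metric E M) {x₀ y : M}
    (hy : y ∈ (chartAt E x₀).source) :
    chartMetric g x₀ (extChartAt 𝓘(ℝ, E) x₀ y) = coordMetric g x₀ y := by
  rw [chartMetric, Function.comp_apply, (extChartAt 𝓘(ℝ, E) x₀).left_inv (by simpa using hy)]

/-- This is `∇g = 0` tested on pairs of fields with constant coordinates, again near the centre so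
that it can be differentiated. -/
theorem fderiv_chartMetric {D : Connection E M} {g : Metric E M} {J : AlmostComplexStructure E M}
    (hD : IsUnitary D g J) (x₀ : M) :
    ∀ᶠ z in 𝓝 (extChartAt 𝓘(ℝ, E) x₀ x₀), ∀ u a b, fderiv ℝ (chartMetric g x₀) z u a b =
      chartMetric g x₀ z (chartConnection D x₀ z u a) b +
        chartMetric g x₀ z a (chartConnection D x₀ z u b) := by
  refine eventually_chart_of_eventually ?_
  have hsm := contMDiffAt_coordMetric g x₀
  filter_upwards [chart_source_mem_nhds (mem_chart_source E x₀),
    eventually_differentiableAt_chart hsm] with y hy hd u a b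
  have hG : HasFDerivAt (chartMetric g x₀) (fderiv ℝ (chartMetric g x₀)
    (extChartAt 𝓘(ℝ, E) x₀ y)) (extChartAt 𝓘(ℝ, E) x₀ y) := hd.hasFDerivAt
  have h1 := hD.metric y (ofCoord x₀ y u) _ _ (mdifferentiableAt_ofCoord (x₀ := x₀) hy a)
    (mdifferentiableAt_ofCoord (x₀ := x₀) hy b)
  have h3 := (hG.clm_apply (hasFDerivAt_const a _)).clm_apply (hasFDerivAt_const b _)
  have h4 := mvfderiv_eq_fderiv (a := fun y => coordMetric g x₀ y a b) hy h3.differentiableAt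
    (ofCoord x₀ y u)
  have h5 := congrArg (fun A : E →L[ℝ] ℝ => A u) h3.fderiv
  have h6 : (fun y => g.inner y (ofCoord x₀ y a) (ofCoord x₀ y b)) =ᶠ[𝓝 y]
      fun y => coordMetric g x₀ y a b := by
    filter_upwards [chart_source_mem_nhds hy] with y' hy' using (coordMetric_apply g hy' a b).symm
  have h7 := h6.mfderiv_eq (I := 𝓘(ℝ, E)) (I' := 𝓘(ℝ, ℝ))
  have h8 : mvfderiv 𝓘(ℝ, E) (fun y => g.inner y (ofCoord x₀ y a) (ofCoord x₀ y b)) y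
      (ofCoord x₀ y u) = fderiv ℝ (chartMetric g x₀) (extChartAt 𝓘(ℝ, E) x₀ y) u a b := by
    refine (congrArg (fun A : E →L[ℝ] ℝ => A (ofCoord x₀ y u)) h7).trans (h4.trans ?_)
    rw [coord_ofCoord hy]
    refine h5.trans ?_
    simp
  have hc : ∀ c, D (fun y => ofCoord x₀ y c) y (ofCoord x₀ y u) =
      ofCoord x₀ y (christoffel D x₀ y u c) := fun c => by
    rw [← ofCoord_coord hy (D (fun y => ofCoord x₀ y c) y (ofCoord x₀ y u)),
      coord_cov_ofCoord D hy, coord_ofCoord hy]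
  rw [← h8, h1, hc, hc, chartMetric_extChartAt g hy, chartConnection_extChartAt D hy,
    coordMetric_apply g hy, coordMetric_apply g hy]

/-- The curvature of a unitary connection is skew-symmetric. -/
theorem curvature_skew {D : Connection E M} [D.ContMDiffCovariantDerivative ∞] {g : Metric E M}
    {J : AlmostComplexStructure E M} (hD : IsUnitary D g J) (x : M)
    (u v a b : TangentSpace 𝓘(ℝ, E) x) :
    g.inner x (curvature D x u v a) b = -g.inner x a (curvature D x u v b) := by
  have hx := mem_chart_source E x
  have h := flat_curvature_skew (hasFDerivAt_chartConnection D x) (contDiffAt_chartMetric g x)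
    (fderiv_chartMetric hD x)
    (coord x x u) (coord x x v) (coord x x a) (coord x x b)
  rw [← chartCurvature, chartMetric_extChartAt g hx, coordMetric_apply g hx,
    coordMetric_apply g hx] at h
  simpa only [← coord_curvature, ofCoord_coord hx] using h

end Unitary

end ChartConnection

/-! ### One-forms and traces on `L` in a chart -/

section OneForm

variable {F : Type*} [NormedAddCommGroup F] [NormedSpace ℝ F] [FiniteDimensional ℝ F]
  {L : Type*} [TopologicalSpace L] [ChartedSpace F L] [IsManifold 𝓘(ℝ, F) ∞ L]

/-- The exterior derivative of a 1-form in a chart. -/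
theorem extDerivOneForm_eq {ξ : ∀ p : L, TangentSpace 𝓘(ℝ, F) p →L[ℝ] ℝ} {p : L}
    {ξ' : F → F →L[ℝ] ℝ} (hξ' : DifferentiableAt ℝ ξ' (extChartAt 𝓘(ℝ, F) p p))
    (hξ : ∀ᶠ q in 𝓝 p, ∀ u, ξ q u = ξ' (extChartAt 𝓘(ℝ, F) p q) (coord p q u))
    {X Y : ∀ q : L, TangentSpace 𝓘(ℝ, F) q} (hX : MDiffAt (T% X) p) (hY : MDiffAt (T% Y) p) :
    extDerivOneForm ξ X Y p =
      fderiv ℝ ξ' (extChartAt 𝓘(ℝ, F) p p) (coord p p (X p)) (coord p p (Y p)) -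
        fderiv ℝ ξ' (extChartAt 𝓘(ℝ, F) p p) (coord p p (Y p)) (coord p p (X p)) := by
  have hp := mem_chart_source F p
  have hs := chart_source_mem_nhds hp
  have hval : ∀ Z : ∀ q : L, TangentSpace 𝓘(ℝ, F) q,
      coord p ((extChartAt 𝓘(ℝ, F) p).symm (extChartAt 𝓘(ℝ, F) p p))
        (Z ((extChartAt 𝓘(ℝ, F) p).symm (extChartAt 𝓘(ℝ, F) p p))) = coord p p (Z p) := fun Z => by
    rw [extChartAt_to_inv]
  -- Product rule for `ξ(Z)`. The terms that differentiate the coordinates of `X` and `Y` assemble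
  -- into `ξ([X, Y])` and cancel the bracket term of `extDerivOneForm`.
  have key : ∀ {Z : ∀ q : L, TangentSpace 𝓘(ℝ, F) q}, MDiffAt (T% Z) p →
      ∀ u : TangentSpace 𝓘(ℝ, F) p, mvfderiv 𝓘(ℝ, F) (fun q => ξ q (Z q)) p u =
        fderiv ℝ ξ' (extChartAt 𝓘(ℝ, F) p p) (coord p p u) (coord p p (Z p)) +
          ξ' (extChartAt 𝓘(ℝ, F) p p) (fderiv ℝ ((fun q => coord p q (Z q)) ∘
            (extChartAt 𝓘(ℝ, F) p).symm) (extChartAt 𝓘(ℝ, F) p p) (coord p p u)) := by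
    intro Z hZ u
    have h1 : DifferentiableAt ℝ ((fun q => coord p q (Z q)) ∘ (extChartAt 𝓘(ℝ, F) p).symm)
        (extChartAt 𝓘(ℝ, F) p p) := differentiableAt_comp_extChartAt_symm
      ((mdifferentiableAt_mk_iff (f := id) (x₀ := p) hp).1 hZ).2
    have h2 := hξ'.hasFDerivAt.clm_apply h1.hasFDerivAt
    have h3 : (fun q => ξ q (Z q)) =ᶠ[𝓝 p] fun q => (fun z => ξ' z (((fun q => coord p q (Z q)) ∘
        (extChartAt 𝓘(ℝ, F) p).symm) z)) (extChartAt 𝓘(ℝ, F) p q) := by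
      filter_upwards [hξ, hs] with q h4 h5
      simp only [h4, Function.comp_apply]
      rw [(extChartAt 𝓘(ℝ, F) p).left_inv (by simpa using h5)]
    rw [mvfderiv_congr h3, mvfderiv_comp_extChartAt hp h2.differentiableAt]
    refine (congrArg (fun A : F →L[ℝ] ℝ => A (coord p p u)) h2.fderiv).trans ?_
    rw [← hval Z, add_comm]
    rfl
  rw [extDerivOneForm, key hX, key hY, hξ.self_of_nhds,
    mlieBracket_eq X Y p (X' := (fun q => coord p q (X q)) ∘ (extChartAt 𝓘(ℝ, F) p).symm)
      (Y' := (fun q => coord p q (Y q)) ∘ (extChartAt 𝓘(ℝ, F) p).symm)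
      (Filter.Eventually.of_forall fun _ => rfl) (Filter.Eventually.of_forall fun _ => rfl)]
  simp only [Function.comp_apply, hval, map_sub]
  ring

/-- A 1-form is smooth when its coordinates are. -/
theorem contMDiffAt_oneForm {ξ : ∀ p : L, TangentSpace 𝓘(ℝ, F) p →L[ℝ] ℝ} {p : L}
    {ξ' : F → F →L[ℝ] ℝ} (hξ' : ContDiffAt ℝ ∞ ξ' (extChartAt 𝓘(ℝ, F) p p))
    (hξ : ∀ᶠ q in 𝓝 p, ∀ u, ξ q u = ξ' (extChartAt 𝓘(ℝ, F) p q) (coord p q u)) :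
    ContMDiffAt 𝓘(ℝ, F) (𝓘(ℝ, F).prod 𝓘(ℝ, F →L[ℝ] ℝ)) ∞
      (fun p : L => TotalSpace.mk' (F →L[ℝ] ℝ)
        (E := fun q : L => TangentSpace 𝓘(ℝ, F) q →L[ℝ] ℝ) p (ξ p)) p := by
  refine (contMDiffAt_hom_bundle _).2 ⟨contMDiffAt_id, ?_⟩
  refine (contMDiffAt_comp_extChartAt (x₀ := p) le_rfl hξ').congr_of_eventuallyEq ?_
  filter_upwards [hξ, chart_source_mem_nhds (mem_chart_source F p)] with q h1 h2
  ext c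
  have h3 : ξ q (ofCoord p q c) = ξ' (extChartAt 𝓘(ℝ, F) p q) c := by
    rw [h1, coord_ofCoord h2]
  rw [← h3]
  exact congrArg (fun A : ℝ →ₗ[ℝ] ℝ => A (ξ q (ofCoord p q c)))
    (Bundle.Trivial.linearMapAt_trivialization (𝕜 := ℝ) (B := L) (F := ℝ) q)

/-- The trace of an endomorphism of a tangent space, computed in coordinates. -/
theorem trace_eq_traceCLM_coord {p q : L} (hq : q ∈ (chartAt F p).source)
    (A : TangentSpace 𝓘(ℝ, F) q →ₗ[ℝ] TangentSpace 𝓘(ℝ, F) q) {B : F →L[ℝ] F}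
    (h : ∀ c, B c = coord p q (A (ofCoord p q c))) :
    LinearMap.trace ℝ (TangentSpace 𝓘(ℝ, F) q) A = traceCLM F B := by
  have h1 : B.toLinearMap = ((coord p q).toLinearMap ∘ₗ A) ∘ₗ (ofCoord p q).toLinearMap :=
    LinearMap.ext h
  have h2 : (ofCoord p q).toLinearMap ∘ₗ ((coord p q).toLinearMap ∘ₗ A) = A :=
    LinearMap.ext fun v => ofCoord_coord hq _
  rw [traceCLM_apply, h1, LinearMap.trace_comp_comm', h2]

end OneForm

variable {E : Type*} [NormedAddCommGroup E] [NormedSpace ℝ E]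
  {M : Type*} [TopologicalSpace M] [ChartedSpace E M] [IsManifold 𝓘(ℝ, E) ∞ M]
  [FiniteDimensional ℝ E] [T2Space M]
  {F : Type*} [NormedAddCommGroup F] [NormedSpace ℝ F] [FiniteDimensional ℝ F]
  {L : Type*} [TopologicalSpace L] [ChartedSpace F L] [IsManifold 𝓘(ℝ, F) ∞ L]

namespace TotallyRealImmersion

variable {J : AlmostComplexStructure E M} (φ : TotallyRealImmersion F L J)

/-! ### The algebraic relations between `J`, `ι_*` and `J π_J` -/

section Linear

theorem push_JpiJ (p : L) (v : TangentSpace 𝓘(ℝ, E) (φ.toFun p)) :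
    φ.push p (φ.JpiJ p v) = φ.cplx p (φ.piJ p v) := by
  have h := LinearEquiv.ofInjective_symm_apply (φ.push p).toLinearMap
    (h := φ.push_injective p) ((φ.cplx p ∘ₗ φ.piJ p).codRestrict (φ.plane p) (φ.cplx_piJ_mem p) v)
  exact h

theorem JpiJ_cplx_push (p : L) (v : TangentSpace 𝓘(ℝ, F) p) :
    φ.JpiJ p (φ.cplx p (φ.push p v)) = -v := by
  apply φ.push_injective p
  change φ.push p _ = φ.push p _
  have h : φ.piJ p (φ.cplx p (φ.push p v)) = φ.cplx p (φ.push p v) := by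
    rw [piJ, Submodule.projection_eq_self_iff]
    exact Submodule.mem_map_of_mem ⟨v, rfl⟩
  rw [push_JpiJ, h, map_neg]
  exact J.sq _ _

/-- The decomposition of a tangent vector of `M` along `T_pL ⊕ J(T_pL)`. -/
theorem eq_push_add_cplx_push (p : L) (v : TangentSpace 𝓘(ℝ, E) (φ.toFun p)) :
    v = -φ.push p (φ.JpiJ p (φ.cplx p v)) - φ.cplx p (φ.push p (φ.JpiJ p v)) := by
  have h : v ∈ φ.plane p ⊔ (φ.plane p).map (φ.cplx p) := by
    rw [(φ.isCompl p).sup_eq_top]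
    trivial
  obtain ⟨_, ⟨a, rfl⟩, _, ⟨_, ⟨b, rfl⟩, rfl⟩, rfl⟩ := Submodule.mem_sup.1 h
  have hb : φ.cplx p (φ.cplx p (φ.push p b)) = -φ.push p b := J.sq _ _
  change φ.push p a + φ.cplx p (φ.push p b) = -φ.push p (φ.JpiJ p (φ.cplx p (φ.push p a +
    φ.cplx p (φ.push p b)))) - φ.cplx p (φ.push p (φ.JpiJ p (φ.push p a + φ.cplx p (φ.push p b))))
  simp only [map_add, map_neg, hb, JpiJ_push, JpiJ_cplx_push]
  simp

end Linear

/-! ### The immersion and its projection in charts -/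

section Chart

/-- The immersion in the charts centred at `p` and `ι(p)`. -/
def chartMap (p : L) : F → E :=
  (extChartAt 𝓘(ℝ, E) (φ.toFun p) ∘ φ.toFun) ∘ (extChartAt 𝓘(ℝ, F) p).symm

theorem contDiffAt_chartMap (p : L) :
    ContDiffAt ℝ ∞ (φ.chartMap p) (extChartAt 𝓘(ℝ, F) p p) :=
  contDiffAt_comp_extChartAt_symm (contMDiffAt_extChartAt.comp p φ.contMDiff.contMDiffAt)

theorem chartMap_extChartAt {p q : L} (hq : q ∈ (chartAt F p).source) :
    φ.chartMap p (extChartAt 𝓘(ℝ, F) p q) = extChartAt 𝓘(ℝ, E) (φ.toFun p) (φ.toFun q) := by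
  rw [chartMap, Function.comp_apply, (extChartAt 𝓘(ℝ, F) p).left_inv (by simpa using hq)]
  rfl

theorem contDiffAt_fderiv_chartMap (p : L) :
    ContDiffAt ℝ ∞ (fderiv ℝ (φ.chartMap p)) (extChartAt 𝓘(ℝ, F) p p) :=
  (φ.contDiffAt_chartMap p).fderiv_right (by simp)

theorem contDiffAt_fderiv_fderiv_chartMap (p : L) :
    ContDiffAt ℝ ∞ (fderiv ℝ (fderiv ℝ (φ.chartMap p))) (extChartAt 𝓘(ℝ, F) p p) :=
  (φ.contDiffAt_fderiv_chartMap p).fderiv_right (by simp)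

/-- The points `q` of `L` near `p` at which the charts centred at `p` and `ι(p)` may be used. -/
def IsChartPoint (p q : L) : Prop :=
  q ∈ (chartAt F p).source ∧ φ.toFun q ∈ (chartAt E (φ.toFun p)).source ∧
    ContDiffAt ℝ 2 (φ.chartMap p) (extChartAt 𝓘(ℝ, F) p q)

theorem eventually_isChartPoint (p : L) : ∀ᶠ q in 𝓝 p, φ.IsChartPoint p q := by
  have h1 : ∀ᶠ q in 𝓝 p, φ.toFun q ∈ (chartAt E (φ.toFun p)).source :=
    φ.contMDiff.continuous.continuousAt.preimage_mem_nhds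
      (chart_source_mem_nhds (mem_chart_source E (φ.toFun p)))
  have h2 := eventually_extChartAt (((φ.contDiffAt_chartMap p).of_le (m := 2)
    (by simpa using ENat.LEInfty.out)).eventually (by simp))
  filter_upwards [chart_source_mem_nhds (mem_chart_source F p), h1, h2] with q h3 h4 h5
  exact ⟨h3, h4, h5⟩

theorem isChartPoint_self (p : L) : φ.IsChartPoint p p :=
  (φ.eventually_isChartPoint p).self_of_nhds

/-- The differential of the immersion in coordinates. -/
theorem coord_push {p q : L} (hq : φ.IsChartPoint p q) (v : TangentSpace 𝓘(ℝ, F) q) :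
    coord (φ.toFun p) (φ.toFun q) (φ.push q v) =
      fderiv ℝ (φ.chartMap p) (extChartAt 𝓘(ℝ, F) p q) (coord p q v) := by
  have h1 := mvfderiv_eq_fderiv (a := extChartAt 𝓘(ℝ, E) (φ.toFun p) ∘ φ.toFun) hq.1
    (hq.2.2.differentiableAt (by simp)) v
  refine Eq.trans ?_ h1
  have h2 := mfderiv_comp (I := 𝓘(ℝ, F)) (I' := 𝓘(ℝ, E)) (I'' := 𝓘(ℝ, E)) q
    (mdifferentiableAt_extChartAt (I := 𝓘(ℝ, E)) hq.2.1)
    ((φ.contMDiff q).mdifferentiableAt (by simp))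
  rw [coord, TangentBundle.continuousLinearMapAt_trivializationAt hq.2.1]
  exact (congrArg (fun A : F →L[ℝ] E => A v) h2).symm

/-- The map `J π_J` in coordinates. -/
def coordJpiJ (p q : L) : E →L[ℝ] F :=
  LinearMap.toContinuousLinearMap
    ((coord p q).toLinearMap ∘ₗ φ.JpiJ q ∘ₗ (ofCoord (φ.toFun p) (φ.toFun q)).toLinearMap)

theorem coordJpiJ_coord {p q : L} (hq : φ.IsChartPoint p q)
    (v : TangentSpace 𝓘(ℝ, E) (φ.toFun q)) :
    φ.coordJpiJ p q (coord (φ.toFun p) (φ.toFun q) v) = coord p q (φ.JpiJ q v) := by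
  simp [coordJpiJ, ofCoord_coord hq.2.1]

/-- The map `J π_J` in the charts centred at `p` and `ι(p)`. -/
def chartJpiJ (p : L) : F → E →L[ℝ] F :=
  φ.coordJpiJ p ∘ (extChartAt 𝓘(ℝ, F) p).symm

theorem chartJpiJ_coord {p q : L} (hq : φ.IsChartPoint p q)
    (v : TangentSpace 𝓘(ℝ, E) (φ.toFun q)) :
    φ.chartJpiJ p (extChartAt 𝓘(ℝ, F) p q) (coord (φ.toFun p) (φ.toFun q) v) =
      coord p q (φ.JpiJ q v) := by
  rw [chartJpiJ, Function.comp_apply, (extChartAt 𝓘(ℝ, F) p).left_inv (by simpa using hq.1),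
    coordJpiJ_coord φ hq]

/-- The almost complex structure along `L` in the charts. -/
def chartCplx (p : L) : F → E →L[ℝ] E :=
  chartComplex J (φ.toFun p) ∘ φ.chartMap p

theorem chartCplx_coord {p q : L} (hq : φ.IsChartPoint p q)
    (v : TangentSpace 𝓘(ℝ, E) (φ.toFun q)) :
    φ.chartCplx p (extChartAt 𝓘(ℝ, F) p q) (coord (φ.toFun p) (φ.toFun q) v) =
      coord (φ.toFun p) (φ.toFun q) (φ.cplx q v) := by
  rw [chartCplx, Function.comp_apply, chartMap_extChartAt φ hq.1,
    chartComplex_extChartAt J hq.2.1, coordComplex_coord J hq.2.1]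
  rfl

theorem chartMap_self (p : L) : φ.chartMap p (extChartAt 𝓘(ℝ, F) p p) =
    extChartAt 𝓘(ℝ, E) (φ.toFun p) (φ.toFun p) :=
  φ.chartMap_extChartAt (mem_chart_source F p)

theorem contDiffAt_chartCplx (p : L) :
    ContDiffAt ℝ ∞ (φ.chartCplx p) (extChartAt 𝓘(ℝ, F) p p) :=
  ContDiffAt.comp _ (by rw [chartMap_self]; exact contDiffAt_chartComplex J _)
    (φ.contDiffAt_chartMap p)

theorem exists_coord_eq {p q : L} (hq : φ.IsChartPoint p q) (c : E) :
    ∃ v, c = coord (φ.toFun p) (φ.toFun q) v :=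
  ⟨ofCoord _ _ c, (coord_ofCoord hq.2.1 c).symm⟩

theorem exists_coord_eq_source {p q : L} (hq : φ.IsChartPoint p q) (c : F) :
    ∃ v, c = coord p q v :=
  ⟨ofCoord _ _ c, (coord_ofCoord hq.1 c).symm⟩

theorem chartCplx_sq {p q : L} (hq : φ.IsChartPoint p q) (v : E) :
    φ.chartCplx p (extChartAt 𝓘(ℝ, F) p q) (φ.chartCplx p (extChartAt 𝓘(ℝ, F) p q) v) = -v := by
  obtain ⟨v, rfl⟩ := φ.exists_coord_eq hq v
  rw [chartCplx_coord φ hq, chartCplx_coord φ hq, ← map_neg]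
  exact congrArg _ (J.sq _ _)

theorem chartJpiJ_fderiv {p q : L} (hq : φ.IsChartPoint p q) (w : F) :
    φ.chartJpiJ p (extChartAt 𝓘(ℝ, F) p q)
      (fderiv ℝ (φ.chartMap p) (extChartAt 𝓘(ℝ, F) p q) w) = 0 := by
  obtain ⟨w, rfl⟩ := φ.exists_coord_eq_source hq w
  rw [← coord_push φ hq, chartJpiJ_coord φ hq, JpiJ_push, map_zero]

theorem chartJpiJ_chartCplx_fderiv {p q : L} (hq : φ.IsChartPoint p q) (w : F) :
    φ.chartJpiJ p (extChartAt 𝓘(ℝ, F) p q) (φ.chartCplx p (extChartAt 𝓘(ℝ, F) p q)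
      (fderiv ℝ (φ.chartMap p) (extChartAt 𝓘(ℝ, F) p q) w)) = -w := by
  obtain ⟨w, rfl⟩ := φ.exists_coord_eq_source hq w
  rw [← coord_push φ hq, chartCplx_coord φ hq, chartJpiJ_coord φ hq, JpiJ_cplx_push, map_neg]

theorem chart_decomposition {p q : L} (hq : φ.IsChartPoint p q) (v : E) :
    v = -fderiv ℝ (φ.chartMap p) (extChartAt 𝓘(ℝ, F) p q) (φ.chartJpiJ p (extChartAt 𝓘(ℝ, F) p q)
        (φ.chartCplx p (extChartAt 𝓘(ℝ, F) p q) v)) -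
      φ.chartCplx p (extChartAt 𝓘(ℝ, F) p q) (fderiv ℝ (φ.chartMap p) (extChartAt 𝓘(ℝ, F) p q)
        (φ.chartJpiJ p (extChartAt 𝓘(ℝ, F) p q) v)) := by
  obtain ⟨v, rfl⟩ := φ.exists_coord_eq hq v
  rw [chartCplx_coord φ hq, chartJpiJ_coord φ hq, chartJpiJ_coord φ hq, ← coord_push φ hq,
    ← coord_push φ hq, chartCplx_coord φ hq, ← map_neg, ← map_sub, ← eq_push_add_cplx_push]

/-- Turns identities at points of `L` into identities on a neighbourhood in `F`, the form in which
they can be differentiated. -/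
theorem eventually_chart_isChartPoint {p : L} {r : F → Prop}
    (h : ∀ q, φ.IsChartPoint p q → r (extChartAt 𝓘(ℝ, F) p q)) :
    ∀ᶠ z in 𝓝 (extChartAt 𝓘(ℝ, F) p p), r z :=
  eventually_chart_of_eventually ((φ.eventually_isChartPoint p).mono h)

/-- `J π_J` is defined point by point; its smooth dependence on the point comes only from the
algebraic relations with the smooth maps `Φ` and `J`. -/
theorem contDiffAt_chartJpiJ (p : L) :
    ContDiffAt ℝ ∞ (φ.chartJpiJ p) (extChartAt 𝓘(ℝ, F) p p) :=
  contDiffAt_of_frame (φ.contDiffAt_fderiv_chartMap p) (φ.contDiffAt_chartCplx p)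
    (φ.eventually_chart_isChartPoint fun _ hq => φ.chartCplx_sq hq)
    (φ.eventually_chart_isChartPoint fun _ hq => φ.chartJpiJ_fderiv hq)
    (φ.eventually_chart_isChartPoint fun _ hq => φ.chartJpiJ_chartCplx_fderiv hq)
    (φ.eventually_chart_isChartPoint fun _ hq => φ.chart_decomposition hq)

/-! ### The Maslov form in charts -/

variable (D : Connection E M)

/-- The connection form of the pull-back connection in the charts. -/
def chartPullback (p : L) (z : F) : F →L[ℝ] E →L[ℝ] E :=
  (chartConnection D (φ.toFun p) (φ.chartMap p z)).comp (fderiv ℝ (φ.chartMap p) z)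

/-- The Maslov form in the charts. -/
def chartMaslov (p : L) (z : F) : F →L[ℝ] ℝ :=
  (traceCLM F).comp ((ContinuousLinearMap.compL ℝ F E F (φ.chartJpiJ p z)).comp
    (fderiv ℝ (fderiv ℝ (φ.chartMap p)) z +
      ((ContinuousLinearMap.compL ℝ F E E).flip (fderiv ℝ (φ.chartMap p) z)).comp
        (φ.chartPullback D p z)))

theorem chartMaslov_apply (p : L) (z u : F) :
    φ.chartMaslov D p z u = traceCLM F (φ.chartJpiJ p z ∘L (fderiv ℝ (fderiv ℝ (φ.chartMap p)) z u +
      φ.chartPullback D p z u ∘L fderiv ℝ (φ.chartMap p) z)) := rfl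

/-- By tensoriality any differentiable extension may be used. Fields with constant coordinates in
the chart at `p` serve all nearby `q` at once. -/
theorem maslovEndomorphism_ofCoord {p q : L} (hq : q ∈ (chartAt F p).source)
    (u : TangentSpace 𝓘(ℝ, F) q) (c : F) :
    φ.maslovEndomorphism D q u (ofCoord p q c) =
      φ.JpiJ q (pullbackCov D φ.toFun (fun q => φ.push q (ofCoord p q c)) q u) := by
  have h := TensorialAt.mkHom_apply (φ.tensorialAt D q u)
    (mdifferentiableAt_ofCoord (x₀ := p) hq c)
  rw [maslovEndomorphism]
  exact h

/-- In coordinates the field `ι_*` of a constant `c` is `Φ c`, and the right side is `N_u c`. The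
hypothesis concerns a neighbourhood of `q` because `Φ c` is differentiated at `q`. -/
theorem coord_pullbackCov_push {p q : L} (hq : ∀ᶠ q' in 𝓝 q, φ.IsChartPoint p q')
    (u : TangentSpace 𝓘(ℝ, F) q) (c : F) :
    coord (φ.toFun p) (φ.toFun q)
        (pullbackCov D φ.toFun (fun q => φ.push q (ofCoord p q c)) q u) =
      (fderiv ℝ (fderiv ℝ (φ.chartMap p)) (extChartAt 𝓘(ℝ, F) p q) (coord p q u) +
        φ.chartPullback D p (extChartAt 𝓘(ℝ, F) p q) (coord p q u) ∘L
          fderiv ℝ (φ.chartMap p) (extChartAt 𝓘(ℝ, F) p q)) c := by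
  have hq0 := hq.self_of_nhds
  have h2 := coord_pullbackCov D hq0.2.1
    (φ.mdifferentiableAt_push (mdifferentiableAt_ofCoord (x₀ := p) hq0.1 c)) u
  have h3 : (fun q' => coord (φ.toFun p) (φ.toFun q') (φ.push q' (ofCoord p q' c))) =ᶠ[𝓝 q]
      fun q' => (fun z => fderiv ℝ (φ.chartMap p) z c) (extChartAt 𝓘(ℝ, F) p q') := by
    filter_upwards [hq] with q' hq'
    rw [coord_push φ hq', coord_ofCoord hq'.1]
  -- Order two in `IsChartPoint` is there for this derivative of the differential.
  have h4 : HasFDerivAt (fderiv ℝ (φ.chartMap p)) (fderiv ℝ (fderiv ℝ (φ.chartMap p))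
      (extChartAt 𝓘(ℝ, F) p q)) (extChartAt 𝓘(ℝ, F) p q) :=
    ((hq0.2.2.fderiv_right (m := 1) (by norm_num)).differentiableAt one_ne_zero).hasFDerivAt
  have h5 := h4.clm_apply (hasFDerivAt_const c _)
  have h6 := congrArg (fun A : F →L[ℝ] E => A (coord p q u)) h5.fderiv
  have h7 : coord (φ.toFun p) (φ.toFun q) (mfderiv 𝓘(ℝ, F) 𝓘(ℝ, E) φ.toFun q u) =
      fderiv ℝ (φ.chartMap p) (extChartAt 𝓘(ℝ, F) p q) (coord p q u) := coord_push φ hq0 u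
  rw [mvfderiv_congr h3, mvfderiv_comp_extChartAt hq0.1 h5.differentiableAt, h7,
    coord_push φ hq0, coord_ofCoord hq0.1] at h2
  refine h2.trans ?_
  rw [_root_.add_apply]
  refine congrArg₂ (· + ·) (h6.trans ?_) ?_
  · simp
  · rw [chartPullback, chartMap_extChartAt φ hq0.1, chartConnection_extChartAt D hq0.2.1]
    rfl

theorem maslovForm_apply (q : L) (u : TangentSpace 𝓘(ℝ, F) q) :
    φ.maslovForm D q u = LinearMap.trace ℝ (TangentSpace 𝓘(ℝ, F) q)
      (φ.maslovEndomorphism D q u).toLinearMap := rfl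

theorem maslovForm_eq_chartMaslov {p q : L} (hq : ∀ᶠ q' in 𝓝 q, φ.IsChartPoint p q')
    (u : TangentSpace 𝓘(ℝ, F) q) :
    φ.maslovForm D q u = φ.chartMaslov D p (extChartAt 𝓘(ℝ, F) p q) (coord p q u) := by
  have hq0 := hq.self_of_nhds
  rw [chartMaslov_apply, maslovForm_apply]
  refine trace_eq_traceCLM_coord hq0.1 _ fun c => ?_
  rw [ContinuousLinearMap.coe_coe, maslovEndomorphism_ofCoord φ D hq0.1, ← chartJpiJ_coord φ hq0,
    coord_pullbackCov_push φ D hq]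
  rfl

theorem eventually_maslovForm_eq (p : L) : ∀ᶠ q in 𝓝 p, ∀ u, φ.maslovForm D q u =
    φ.chartMaslov D p (extChartAt 𝓘(ℝ, F) p q) (coord p q u) := by
  filter_upwards [eventually_eventually_nhds.2 (φ.eventually_isChartPoint p)] with q hq u
  exact φ.maslovForm_eq_chartMaslov D hq u

/-! ### Trace of the curvature and exterior derivative of the Maslov form -/

variable [D.ContMDiffCovariantDerivative ∞]

/-- Both real quantities are read off from one complex trace `t`: `chernForm` is the real trace of
`J R` in an orthonormal basis. -/
theorem exists_hasComplexTrace_curvature {g : Metric E M} (hD : IsUnitary D g J) (p : L)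
    (u v : TangentSpace 𝓘(ℝ, F) p) {ι : Type*} [Fintype ι] [DecidableEq ι]
    (e : Basis ι ℝ (TangentSpace 𝓘(ℝ, E) (φ.toFun p)))
    (he : ∀ i j, g.inner (φ.toFun p) (e i) (e j) = if i = j then 1 else 0) :
    ∃ t : ℂ, HasComplexTrace (J.toFun (φ.toFun p)).toLinearMap (J.sq (φ.toFun p))
      (curvature D (φ.toFun p) (φ.push p u) (φ.push p v)) t ∧ t.re = 0 ∧
      φ.traceCurvature D p u v = -t.im ∧
      chernForm D g J (φ.toFun p) e (φ.push p u) (φ.push p v) = -(2 * t.im) := by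
  obtain ⟨t, h1, h2, h3, h4⟩ := exists_hasComplexTrace (J := φ.cplx p) (J.sq (φ.toFun p))
    (Φ := (φ.push p).toLinearMap) (Q := φ.JpiJ p) (φ.JpiJ_push p) (φ.JpiJ_cplx_push p)
    (φ.eq_push_add_cplx_push p) (R := curvature D (φ.toFun p) (φ.push p u) (φ.push p v))
    (curvature_complex hD (φ.toFun p) _ _)
  have htr := trace_eq_sum_of_orthonormal e
    ((ContinuousLinearMap.coeLM ℝ).comp (g.inner (φ.toFun p)).toLinearMap) he
  refine ⟨t, h1, ?_, h2, (htr _).symm.trans h4⟩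
  -- Skew-symmetry makes each diagonal term `g(R e_j, e_j)` vanish, so the real trace `2 Re t` is
  -- zero.
  rw [htr, Finset.sum_eq_zero] at h3
  · linarith
  · intro j _
    have h5 := curvature_skew hD (φ.toFun p) (φ.push p u) (φ.push p v) (e j) (e j)
    have h6 := g.symm (φ.toFun p) (e j) (curvature D (φ.toFun p) (φ.push p u) (φ.push p v) (e j))
    change g.inner (φ.toFun p) (curvature D (φ.toFun p) (φ.push p u) (φ.push p v) (e j)) (e j) = 0
    linarith

theorem contDiffAt_chartConnection_chartMap (p : L) :
    ContDiffAt ℝ ∞ (chartConnection D (φ.toFun p) ∘ φ.chartMap p) (extChartAt 𝓘(ℝ, F) p p) := by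
  have h : ContDiffAt ℝ ∞ (chartConnection D (φ.toFun p))
      (φ.chartMap p (extChartAt 𝓘(ℝ, F) p p)) := by
    rw [chartMap_self]
    exact contDiffAt_chartConnection D _
  exact h.comp _ (φ.contDiffAt_chartMap p)

theorem contDiffAt_chartPullback (p : L) :
    ContDiffAt ℝ ∞ (φ.chartPullback D p) (extChartAt 𝓘(ℝ, F) p p) :=
  (φ.contDiffAt_chartConnection_chartMap D p).clm_comp (φ.contDiffAt_fderiv_chartMap p)

theorem contDiffAt_chartMaslov (p : L) :
    ContDiffAt ℝ ∞ (φ.chartMaslov D p) (extChartAt 𝓘(ℝ, F) p p) := by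
  refine contDiffAt_const.clm_comp (ContDiffAt.clm_comp
    (contDiffAt_const.clm_apply (φ.contDiffAt_chartJpiJ p))
    ((φ.contDiffAt_fderiv_fderiv_chartMap p).add (ContDiffAt.clm_comp
      (contDiffAt_const.clm_apply (φ.contDiffAt_fderiv_chartMap p))
      (φ.contDiffAt_chartPullback D p))))

theorem traceCurvature_eq (p : L) (u v : TangentSpace 𝓘(ℝ, F) p) :
    φ.traceCurvature D p u v = traceCLM F (φ.chartJpiJ p (extChartAt 𝓘(ℝ, F) p p) ∘L
      chartCurvature D (φ.toFun p)
        (fderiv ℝ (φ.chartMap p) (extChartAt 𝓘(ℝ, F) p p) (coord p p u))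
        (fderiv ℝ (φ.chartMap p) (extChartAt 𝓘(ℝ, F) p p) (coord p p v)) ∘L
      fderiv ℝ (φ.chartMap p) (extChartAt 𝓘(ℝ, F) p p)) := by
  have hp := φ.isChartPoint_self p
  refine trace_eq_traceCLM_coord hp.1 _ fun c => ?_
  obtain ⟨w, rfl⟩ := φ.exists_coord_eq_source hp c
  rw [ofCoord_coord hp.1]
  simp only [ContinuousLinearMap.comp_apply]
  rw [← coord_push φ hp, ← coord_push φ hp, ← coord_push φ hp, ← coord_curvature,
    chartJpiJ_coord φ hp]
  rfl

/-- The moving frame computation is applied to `Φ = d(chartMap)` and to the pulled-back connection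
form, whose curvature is the pull-back of `chartCurvature`. -/
theorem extDerivOneForm_maslovForm {g : Metric E M} (hD : IsUnitary D g J) {p : L}
    {X Y : ∀ q : L, TangentSpace 𝓘(ℝ, F) q} (hX : MDiffAt (T% X) p) (hY : MDiffAt (T% Y) p) :
    extDerivOneForm (φ.maslovForm D) X Y p = φ.traceCurvature D p (X p) (Y p) := by
  rw [extDerivOneForm_eq ((φ.contDiffAt_chartMaslov D p).differentiableAt (by simp))
    (φ.eventually_maslovForm_eq D p) hX hY, traceCurvature_eq]
  set u := coord p p (X p)
  set v := coord p p (Y p)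
  set z := extChartAt 𝓘(ℝ, F) p p with hz
  have hp := φ.isChartPoint_self p
  have hd : ∀ u v : F, fderiv ℝ (φ.chartMaslov D p) z u v =
      fderiv ℝ (fun z => φ.chartMaslov D p z v) z u := by
    intro u v
    have h := ((φ.contDiffAt_chartMaslov D p).differentiableAt (by simp)).hasFDerivAt.clm_apply
      (hasFDerivAt_const v z)
    rw [h.fderiv]
    simp
    rfl
  have hΦ := ((φ.contDiffAt_fderiv_chartMap p).differentiableAt (by simp)).hasFDerivAt
  have hdΦ := ((φ.contDiffAt_fderiv_fderiv_chartMap p).differentiableAt (by simp)).hasFDerivAt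
  have hJ := ((φ.contDiffAt_chartCplx p).differentiableAt (by simp)).hasFDerivAt
  have hQ := ((φ.contDiffAt_chartJpiJ p).differentiableAt (by simp)).hasFDerivAt
  have hh := ((φ.contDiffAt_chartMap p).differentiableAt (by simp)).hasFDerivAt
  -- Two symmetries are needed: that of the second derivative removes the extra term in the exterior
  -- derivative of the pulled-back connection form, and that of the third derivative, below, is the
  -- symmetry of the second derivative of the frame `Φ`.
  have hsymm : ∀ u v, fderiv ℝ (fderiv ℝ (φ.chartMap p)) z u v =
      fderiv ℝ (fderiv ℝ (φ.chartMap p)) z v u :=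
    fun u v => (φ.contDiffAt_chartMap p).isSymmSndFDerivAt (by simpa using ENat.LEInfty.out) u v
  have hsymm' : ∀ u v, fderiv ℝ (fderiv ℝ (fderiv ℝ (φ.chartMap p))) z u v =
      fderiv ℝ (fderiv ℝ (fderiv ℝ (φ.chartMap p))) z v u :=
    fun u v => (φ.contDiffAt_fderiv_chartMap p).isSymmSndFDerivAt
      (by simpa using ENat.LEInfty.out) u v
  have hC : HasFDerivAt (chartConnection D (φ.toFun p) ∘ φ.chartMap p)
      (fderiv ℝ (chartConnection D (φ.toFun p)) (φ.chartMap p z) ∘L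
        fderiv ℝ (φ.chartMap p) z) z := by
    refine HasFDerivAt.comp z ?_ hh
    rw [hz, chartMap_self]
    exact hasFDerivAt_chartConnection D _
  have hΓ := hC.clm_comp hΦ
  have hdJ : ∀ u x, fderiv ℝ (φ.chartCplx p) z u x =
      φ.chartCplx p z (φ.chartPullback D p z u x) -
        φ.chartPullback D p z u (φ.chartCplx p z x) := by
    intro u x
    have h1 : DifferentiableAt ℝ (chartComplex J (φ.toFun p)) (φ.chartMap p z) := by
      rw [hz, chartMap_self]
      exact (contDiffAt_chartComplex J _).differentiableAt (by simp)
    have h2 := (h1.hasFDerivAt.comp z hh).fderiv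
    have h3 := (fderiv_chartComplex hD (φ.toFun p)).self_of_nhds (fderiv ℝ (φ.chartMap p) z u)
    rw [← chartMap_self, ← hz] at h3
    rw [chartCplx, h2, ContinuousLinearMap.comp_apply, h3]
    rfl
  -- The relations on `Q` are supplied near `z`, to be differentiated; the splitting and the
  -- equation for the derivative of `J` are used only at `z`.
  have key := extDeriv_trace_moving_frame hΦ hdΦ hΓ hJ hQ
    hsymm' (φ.chart_decomposition hp)
    (φ.eventually_chart_isChartPoint fun _ hq => ContinuousLinearMap.ext (φ.chartJpiJ_fderiv hq))
    (φ.eventually_chart_isChartPoint fun _ hq =>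
      ContinuousLinearMap.ext (φ.chartJpiJ_chartCplx_fderiv hq)) hdJ u v
  rw [hd, hd]
  refine key.trans ?_
  congr 3
  simp only [_root_.add_apply, ContinuousLinearMap.comp_apply, ContinuousLinearMap.compL_apply,
    ContinuousLinearMap.flip_apply, Function.comp_apply, ← hz]
  rw [hsymm v u, chartCurvature, ← chartMap_self, ← hz]
  abel

end Chart
end TotallyRealImmersion

end

end TotallyReal

theorem proposition4p2
    -- the almost Hermitian manifold `(M, J, g)`
    {E : Type*} [NormedAddCommGroup E] [NormedSpace ℝ E] [FiniteDimensional ℝ E]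
    {M : Type*} [TopologicalSpace M] [T2Space M] [ChartedSpace E M] [IsManifold 𝓘(ℝ, E) ∞ M]
    (J : TotallyReal.AlmostComplexStructure E M) (g : TotallyReal.Metric E M)
    (hgJ : TotallyReal.IsAlmostHermitian g J)
    -- the smooth unitary connection
    (D : TotallyReal.Connection E M) [D.ContMDiffCovariantDerivative ∞]
    (hD : TotallyReal.IsUnitary D g J)
    -- the totally real submanifold
    {F : Type*} [NormedAddCommGroup F] [NormedSpace ℝ F] [FiniteDimensional ℝ F]
    {L : Type*} [TopologicalSpace L] [T2Space L] [ChartedSpace F L] [IsManifold 𝓘(ℝ, F) ∞ L]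
    (φ : TotallyReal.TotallyRealImmersion F L J) :
    -- `ξ_J` is a smooth 1-form
    ContMDiff 𝓘(ℝ, F) (𝓘(ℝ, F).prod 𝓘(ℝ, F →L[ℝ] ℝ)) ∞
      (fun p : L => TotalSpace.mk' (F →L[ℝ] ℝ)
        (E := fun q : L => TangentSpace 𝓘(ℝ, F) q →L[ℝ] ℝ) p (φ.maslovForm D p)) ∧
    -- `dξ_J(X, Y) = tr_L (J π_J R(X, Y))`
    (∀ (p : L) (X Y : ∀ q : L, TangentSpace 𝓘(ℝ, F) q),
      MDifferentiableAt 𝓘(ℝ, F) 𝓘(ℝ, F).tangent (fun q => (⟨q, X q⟩ : TangentBundle 𝓘(ℝ, F) L)) p →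
      MDifferentiableAt 𝓘(ℝ, F) 𝓘(ℝ, F).tangent (fun q => (⟨q, Y q⟩ : TangentBundle 𝓘(ℝ, F) L)) p →
      TotallyReal.extDerivOneForm (φ.maslovForm D) X Y p = φ.traceCurvature D p (X p) (Y p)) ∧
    -- `tr_L (J π_J R(X, Y)) = P(X, Y) / 2`, and this is the value of the form `i tr_ℂ R`
    (∀ (p : L) (X Y : TangentSpace 𝓘(ℝ, F) p)
      (e : Module.Basis (Fin (Module.finrank ℝ E)) ℝ (TangentSpace 𝓘(ℝ, E) (φ.toFun p))),
      (∀ i j, g.inner (φ.toFun p) (e i) (e j) = if i = j then 1 else 0) →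
      φ.traceCurvature D p X Y =
        1 / 2 * TotallyReal.chernForm D g J (φ.toFun p) e (φ.push p X) (φ.push p Y) ∧
      ∃ t : ℂ, TotallyReal.HasComplexTrace (J.toFun (φ.toFun p)).toLinearMap (J.sq (φ.toFun p))
          (TotallyReal.curvature D (φ.toFun p) (φ.push p X) (φ.push p Y)) t ∧
        Complex.I * t = ((1 / 2 * TotallyReal.chernForm D g J (φ.toFun p) e
          (φ.push p X) (φ.push p Y) : ℝ) : ℂ)) := by
  refine ⟨fun p => TotallyReal.contMDiffAt_oneForm (φ.contDiffAt_chartMaslov D p)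
      (φ.eventually_maslovForm_eq D p),
    fun p X Y hX hY => φ.extDerivOneForm_maslovForm D hD hX hY, fun p X Y e he => ?_⟩
  obtain ⟨t, h1, h2, h3, h4⟩ := φ.exists_hasComplexTrace_curvature D hD p X Y e he
  refine ⟨by rw [h3, h4]; ring, t, h1, ?_⟩
  rw [h4]
  -- The real part of `i t` is `-Im t`; its imaginary part is `Re t = 0`.
  apply Complex.ext
  · simp
  · simp [h2]
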